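/- Let $K_1,K_2:[0,1]\to\mathbb R$ be continuous with $K_1(x)<0<K_2(x)$ for all $x\in[0,1]$ and with distributional second derivatives $K_1'',K_2''\in L^2([0,1])$. Let $\alpha\in\mathbb R$, and let $f,\sigma:[0,1]\times\mathbb R\to\mathbb R$ be measurable, bounded, and such that for some $L>0$ $$|f(x,y)-f(x,\hat y)|+|\sigma(x,y)-\sigma(x,\hat y)|\le L|y-\hat y|\qquad (x\in[0,1],\ y,\hat y\in\mathbb R).$$ For $S>0$, $\dot h\in L^2([0,1]\times[0,S])$ and $u_0\in E:=\{z\in C([0,1]):K_1\le z\le K_2\}$, a solution on $[0,S]$ of the reflected skeleton equation $$\partial_t u=\partial_x^2u-\alpha u+f(x,u)+\sigma(x,u)\dot h+\eta-\xi,\quad K_1\le u\le K_2,\quad u(\cdot,0)=u_0,\quad \partial_xu(0,t)=\partial_xu(1,t)=0$$ is a continuous function $u$ on $[0,1]\times[0,S]$ with $K_1(x)\le u(x,t)\le K_2(x)$ and $u(\cdot,0)=u_0$, for which there are finite positive measures $\eta,\xi$ on $[0,1]\times[0,S]$ such that $$\int_{[0,1]\times[0,S]}(u-K_1)\,d\eta=\int_{[0,1]\times[0,S]}(K_2-u)\,d\xi=0$$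 and, for all $t\in[0,S]$ and all $\phi\in C^\infty([0,1])$ with $\phi'(0)=\phi'(1)=0$, $$\begin{aligned}&(u(t),\phi)-\int_0^t(u(s),\phi'')\,ds-\int_0^t(f(\cdot,u(s)),\phi)\,ds-\int_0^t\!\int_0^1\phi(x)\,\sigma(x,u(x,s))\,\dot h(x,s)\,dx\,ds\\&\quad=(u_0,\phi)-\alpha\int_0^t(u(s),\phi)\,ds+\int_{[0,1]\times[0,t]}\phi(x)\,\eta(dx,ds)-\int_{[0,1]\times[0,t]}\phi(x)\,\xi(dx,ds),\end{aligned}$$ where $(\cdot,\cdot)$ is the inner product of $L^2([0,1])$ and $u(t)=u(\cdot,t)$. Then there is a function $C(\cdot,\cdot)$, depending only on $K_1,K_2,\alpha,f,\sigma$, with the following property. Let $T_0>0$, let $\dot{\bar h}\in L^2([0,1]\times[0,T_0])$ and write $\|\bar h\|=\|\dot{\bar h}\|_{L^2([0,1]\times[0,T_0])}$. Let $z\in E$ and $T>0$, and let $u^0(z,\cdot,\cdot)$ be a solution on $[0,T]$ with initial value $z$ and control $0$. Let $\psi$ and $\bar\psi$ be solutions on $[0,T_0]$ with the same control $\dot{\bar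 h}$ and with initial values $\psi(\cdot,0)=0$ and $\bar\psi(\cdot,0)=u^0(z,\cdot,T)$. Then $$\sup_{0\le t\le T_0}\ \sup_{x\in[0,1]}|\psi(x,t)-\bar\psi(x,t)|\ \le\ C(T_0,\|\bar h\|)\ \sup_{x\in[0,1]}|u^0(z,x,T)|.$$ -/

import Mathlib

open Set MeasureTheory
open scoped ContDiff

namespace ReflectedSkeleton

/-- The closed space-time rectangle `[0,1] × [0,S]`; points are written `(x, t)`. -/
def rect (S : ℝ) : Set (ℝ × ℝ) := Icc (0 : ℝ) 1 ×ˢ Icc (0 : ℝ) S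

/-- The second distributional derivative of `K` on `(0,1)` belongs to `L²`. -/
def HasL2SecondDerivative (K : ℝ → ℝ) : Prop :=
  ∃ g : ℝ → ℝ, MemLp g 2 (volume.restrict (Icc (0 : ℝ) 1)) ∧
    ∀ φ : ℝ → ℝ, ContDiff ℝ ∞ φ → HasCompactSupport φ → tsupport φ ⊆ Ioo (0 : ℝ) 1 →
      ∫ x in (0 : ℝ)..1, K x * deriv (deriv φ) x = ∫ x in (0 : ℝ)..1, g x * φ x

/-- The conditions on the two reflecting walls. Only the values on `[0,1]` matter. -/
structure AdmissibleWalls (K₁ K₂ : ℝ → ℝ) : Prop where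
  continuousOn_lower : ContinuousOn K₁ (Icc (0 : ℝ) 1)
  continuousOn_upper : ContinuousOn K₂ (Icc (0 : ℝ) 1)
  lower_neg : ∀ x ∈ Icc (0 : ℝ) 1, K₁ x < 0
  upper_pos : ∀ x ∈ Icc (0 : ℝ) 1, 0 < K₂ x
  lower_second_derivative : HasL2SecondDerivative K₁
  upper_second_derivative : HasL2SecondDerivative K₂

/-- The coefficients `f, σ` are (Borel measurable,) bounded on `[0,1] × ℝ`, and Lipschitz in the
second variable, uniformly in the first one. Only the values on `[0,1] × ℝ` matter. -/
structure AdmissibleCoefficients (f σ : ℝ → ℝ → ℝ) : Prop where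
  measurable_f : Measurable (Function.uncurry f)
  measurable_σ : Measurable (Function.uncurry σ)
  bounded : ∃ M : ℝ, ∀ x ∈ Icc (0 : ℝ) 1, ∀ y : ℝ, |f x y| ≤ M ∧ |σ x y| ≤ M
  lipschitz : ∃ L : ℝ, 0 < L ∧ ∀ x ∈ Icc (0 : ℝ) 1, ∀ y y' : ℝ,
    |f x y - f x y'| + |σ x y - σ x y'| ≤ L * |y - y'|

/-- The space `E` of continuous functions on `[0,1]` that lie between the walls. -/
def IsState (K₁ K₂ : ℝ → ℝ) (z : ℝ → ℝ) : Prop :=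
  ContinuousOn z (Icc (0 : ℝ) 1) ∧ ∀ x ∈ Icc (0 : ℝ) 1, K₁ x ≤ z x ∧ z x ≤ K₂ x

/-- `h` is the density of a control on `[0,1] × [0,S]`, i.e. it is square integrable there. -/
def IsControl (S : ℝ) (h : ℝ → ℝ → ℝ) : Prop :=
  MemLp (Function.uncurry h) 2 (volume.restrict (rect S))

/-- The Cameron-Martin norm of a control on `[0,1] × [0,S]`, i.e. the `L²` norm of its density. -/
noncomputable def controlNorm (S : ℝ) (h : ℝ → ℝ → ℝ) : ℝ :=
  (eLpNorm (Function.uncurry h) 2 (volume.restrict (rect S))).toReal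

/-- The triplet `(u, η, ξ)` is a solution on `[0,1] × [0,S]` of the skeleton equation
`∂u/∂t = ∂²u/∂x² - α u + f(x,u) + σ(x,u) h + η - ξ`, `K₁ ≤ u ≤ K₂`,
with homogeneous Neumann boundary conditions and initial value `u₀`. Here `h` is the density of
the control, and `η`, `ξ` are the (locally finite, positive) reflection measures. -/
structure IsSolutionTriplet (K₁ K₂ : ℝ → ℝ) (α : ℝ) (f σ : ℝ → ℝ → ℝ) (h : ℝ → ℝ → ℝ)
    (u₀ : ℝ → ℝ) (S : ℝ) (u : ℝ → ℝ → ℝ) (η ξ : Measure (ℝ × ℝ)) : Prop where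
  continuousOn : ContinuousOn (Function.uncurry u) (rect S)
  between : ∀ x ∈ Icc (0 : ℝ) 1, ∀ t ∈ Icc (0 : ℝ) S, K₁ x ≤ u x t ∧ u x t ≤ K₂ x
  initial : ∀ x ∈ Icc (0 : ℝ) 1, u x 0 = u₀ x
  finite_lower : η (rect S) < ⊤
  finite_upper : ξ (rect S) < ⊤
  weak_form : ∀ t ∈ Icc (0 : ℝ) S, ∀ φ : ℝ → ℝ, ContDiff ℝ ∞ φ → deriv φ 0 = 0 → deriv φ 1 = 0 →
    (∫ x in (0 : ℝ)..1, u x t * φ x)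
        - (∫ s in (0 : ℝ)..t, ∫ x in (0 : ℝ)..1, u x s * deriv (deriv φ) x)
        - (∫ s in (0 : ℝ)..t, ∫ x in (0 : ℝ)..1, f x (u x s) * φ x)
        - (∫ s in (0 : ℝ)..t, ∫ x in (0 : ℝ)..1, φ x * σ x (u x s) * h x s)
      = (∫ x in (0 : ℝ)..1, u₀ x * φ x)
        - α * (∫ s in (0 : ℝ)..t, ∫ x in (0 : ℝ)..1, u x s * φ x)
        + (∫ p in rect t, φ p.1 ∂η) - (∫ p in rect t, φ p.1 ∂ξ)
  complementarity_lower : ∫ p in rect S, (u p.1 p.2 - K₁ p.1) ∂η = 0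
  complementarity_upper : ∫ p in rect S, (K₂ p.1 - u p.1 p.2) ∂ξ = 0

/-- `u` is a solution on `[0,1] × [0,S]` of the reflected skeleton equation with control density
`h` and initial value `u₀`, for some pair of reflection measures. -/
def IsSkeletonSolution (K₁ K₂ : ℝ → ℝ) (α : ℝ) (f σ : ℝ → ℝ → ℝ) (h : ℝ → ℝ → ℝ)
    (u₀ : ℝ → ℝ) (S : ℝ) (u : ℝ → ℝ → ℝ) : Prop :=
  ∃ η ξ : Measure (ℝ × ℝ), IsSolutionTriplet K₁ K₂ α f σ h u₀ S u η ξ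

/-- The supremum of `|z x|` over `x ∈ [0,1]`. -/
noncomputable def supNorm (z : ℝ → ℝ) : ℝ :=
  sSup ((fun x => |z x|) '' Icc (0 : ℝ) 1)

/-- The supremum of `|u x s - v x s|` over `x ∈ [0,1]` and `0 ≤ s ≤ t`. -/
noncomputable def supDist (u v : ℝ → ℝ → ℝ) (t : ℝ) : ℝ :=
  sSup ((fun p : ℝ × ℝ => |u p.1 p.2 - v p.1 p.2|) '' rect t)

end ReflectedSkeleton

/-! The difference w of two solutions with the same control is pushed up only by the lower measure
of the first and the upper measure of the second. Where w > 0, the first solution is above K₁ and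
the second below K₂, so neither of these measures charges {w > 0}: reflection cannot raise the
positive part of w. Hence w is at most the initial gap m plus what the difference a of the two
drifts produces through the Neumann heat equation. In one space dimension this equation maps L²
forcing to bounded functions, because the sum of 1/n² over the modes converges. This is
`IsWeakSolution.le_add_heatBound_mul`; used in both directions it gives |w|² ≤ 2m² + c∫∫a² up to
time t. Since |a| ≤ (|α| + L + L|h|)|w| and this weight is in L², a Gronwall argument in the clock
A(t), the integral of the squared weight up to time t, closes the estimate with a constant depending
only on α, L, T₀ and ‖h‖.

The comparison needs care, as w is merely a continuous weak solution and a is merely L². First, a is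
replaced by a finite cosine sum, whose heat solution is explicit; the remainder is small in L¹. Then
`exists_upper_bound_of_isWeakSolution` compares w with a barrier V by a maximum principle for w - V
mollified in x. The mollifier is folded at 0 and 1, which makes it a legal Neumann test function and
lets the second derivative test work at the endpoints. The L¹ remainder costs a factor sup ρ, but
the mollification scale depends only on the modulus of continuity of w, so it is fixed before the
cosine sum is chosen. -/

namespace ReflectedSkeleton

/-! ### Mollification with Neumann reflection. -/

/-- An even smooth probability density supported in `(-ε, ε)`. -/
structure IsMollifier (ε : ℝ) (ρ : ℝ → ℝ) : Prop where
  contDiff : ContDiff ℝ ∞ ρ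
  nonneg : ∀ z, 0 ≤ ρ z
  even : ∀ z, ρ (-z) = ρ z
  eq_zero : ∀ z, ε ≤ |z| → ρ z = 0
  integral_eq_one : ∫ z, ρ z = 1

theorem exists_isMollifier {ε : ℝ} (hε : 0 < ε) : ∃ ρ, IsMollifier ε ρ := by
  let b : ContDiffBump (0 : ℝ) := ⟨ε / 2, ε, by linarith, by linarith⟩
  refine ⟨b.normed volume, ⟨b.contDiff_normed, b.nonneg_normed, b.normed_neg, ?_,
    b.integral_normed⟩⟩
  intro z hz
  have : z ∉ Function.support (b.normed volume) := by
    rw [b.support_normed_eq]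
    simpa [Metric.mem_ball, Real.dist_eq, b] using hz
  simpa using this

theorem IsMollifier.hasCompactSupport {ε : ℝ} {ρ : ℝ → ℝ} (h : IsMollifier ε ρ) :
    HasCompactSupport ρ := by
  refine HasCompactSupport.intro (isCompact_Icc (a := -ε) (b := ε)) fun z hz => h.eq_zero z ?_
  by_contra! hlt
  exact hz ⟨(abs_lt.1 hlt).1.le, (abs_lt.1 hlt).2.le⟩

theorem exists_abs_le_of_hasCompactSupport {q : ℝ → ℝ} (hq : Continuous q)
    (hc : HasCompactSupport q) : ∃ M, 0 ≤ M ∧ ∀ z, |q z| ≤ M := by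
  obtain ⟨M, hM⟩ := hc.exists_bound_of_continuous hq
  exact ⟨M, (norm_nonneg _).trans (hM 0), hM⟩

/-- The sum of the reflections of `q (x - y)` that can meet `[0,1]`. -/
def foldedKernel (q : ℝ → ℝ) (x y : ℝ) : ℝ := q (x - y) + q (x + y) + q (x + y - 2)

/-- A general `e` treats the three shifts -y, y and y - 2 of `foldedKernel` at once. -/
theorem hasDerivAt_integral_shift {q e r : ℝ → ℝ} (hq : ContDiff ℝ ∞ q)
    (hc : HasCompactSupport q) (he : Continuous e) (hr : ContinuousOn r (Icc 0 1)) (x : ℝ) :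
    HasDerivAt (fun x => ∫ y in (0 : ℝ)..1, r y * q (x + e y))
      (∫ y in (0 : ℝ)..1, r y * deriv q (x + e y)) x := by
  have hq' : Continuous (deriv q) := hq.continuous_deriv (by simp)
  obtain ⟨M, -, hM⟩ := exists_abs_le_of_hasCompactSupport hq' hc.deriv
  have hr' : ContinuousOn r (uIcc 0 1) := by rwa [uIcc_of_le zero_le_one]
  have hint : ∀ g : ℝ → ℝ, Continuous g → ∀ x : ℝ,
      IntervalIntegrable (fun y => r y * g (x + e y)) volume 0 1 := fun g hg x =>
    (hr'.mul (by fun_prop)).intervalIntegrable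
  refine (intervalIntegral.hasDerivAt_integral_of_dominated_loc_of_deriv_le
    (s := univ) (bound := fun y => |r y| * M)
    (F := fun x y => r y * q (x + e y)) (F' := fun x y => r y * deriv q (x + e y)) Filter.univ_mem ?_
    (hint q hq.continuous x) ?_ ?_ ?_ ?_).2
  · exact Filter.Eventually.of_forall fun x => (hint q hq.continuous x).def'.aestronglyMeasurable
  · exact (hint _ hq' x).def'.aestronglyMeasurable
  · refine Filter.Eventually.of_forall fun y _ x _ => ?_
    rw [Real.norm_eq_abs, abs_mul]
    exact mul_le_mul_of_nonneg_left (hM _) (abs_nonneg _)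
  · exact (hr'.abs.mul continuousOn_const).intervalIntegrable
  · refine Filter.Eventually.of_forall fun y _ x _ => ?_
    have h1 : HasDerivAt q (deriv q (x + e y)) (x + e y) :=
      (hq.differentiable (by simp) _).hasDerivAt
    exact (h1.comp_add_const x (e y)).const_mul _

theorem continuous_foldedKernel {q : ℝ → ℝ} (hq : Continuous q) (x : ℝ) :
    Continuous (foldedKernel q x) := by
  unfold foldedKernel
  fun_prop

theorem continuous_uncurry_foldedKernel {q : ℝ → ℝ} (hq : Continuous q) :
    Continuous (fun p : ℝ × ℝ => foldedKernel q p.1 p.2) := by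
  unfold foldedKernel
  fun_prop

theorem abs_foldedKernel_le {q : ℝ → ℝ} {M : ℝ} (hM : ∀ z, |q z| ≤ M) (x y : ℝ) :
    |foldedKernel q x y| ≤ 3 * M := by
  have := (abs_add_three (q (x - y)) (q (x + y)) (q (x + y - 2)))
  unfold foldedKernel
  linarith [hM (x - y), hM (x + y), hM (x + y - 2)]

theorem hasDerivAt_integral_foldedKernel {q r : ℝ → ℝ} (hq : ContDiff ℝ ∞ q)
    (hc : HasCompactSupport q) (hr : ContinuousOn r (Icc 0 1)) (x : ℝ) :
    HasDerivAt (fun x => ∫ y in (0 : ℝ)..1, r y * foldedKernel q x y)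
      (∫ y in (0 : ℝ)..1, r y * foldedKernel (deriv q) x y) x := by
  have hr' : ContinuousOn r (uIcc 0 1) := by rwa [uIcc_of_le zero_le_one]
  have hsplit : ∀ g : ℝ → ℝ, Continuous g → ∀ x,
      ∫ y in (0 : ℝ)..1, r y * foldedKernel g x y =
        (∫ y in (0 : ℝ)..1, r y * g (x + -y)) + (∫ y in (0 : ℝ)..1, r y * g (x + y)) +
          ∫ y in (0 : ℝ)..1, r y * g (x + (y - 2)) := by
    intro g hg x
    rw [← intervalIntegral.integral_add, ← intervalIntegral.integral_add]
    · refine intervalIntegral.integral_congr fun y _ => ?_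
      simp only [foldedKernel, sub_eq_add_neg, add_assoc]
      ring
    all_goals
      first
        | exact (hr'.mul (by fun_prop)).intervalIntegrable
        | exact (hr'.mul (by fun_prop)).intervalIntegrable.add
            (hr'.mul (by fun_prop)).intervalIntegrable
  rw [hsplit _ (hq.continuous_deriv (by simp))]
  simp_rw [hsplit _ hq.continuous]
  exact ((hasDerivAt_integral_shift hq hc (by fun_prop) hr x).add
    (hasDerivAt_integral_shift hq hc (by fun_prop) hr x)).add
    (hasDerivAt_integral_shift hq hc (by fun_prop) hr x)

theorem contDiff_deriv_infty {q : ℝ → ℝ} (hq : ContDiff ℝ ∞ q) : ContDiff ℝ ∞ (deriv q) :=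
  (contDiff_infty_iff_deriv.1 hq).2

theorem contDiff_foldedKernel {q : ℝ → ℝ} (hq : ContDiff ℝ ∞ q) (x : ℝ) :
    ContDiff ℝ ∞ (foldedKernel q x) := by
  unfold foldedKernel
  fun_prop

theorem hasDerivAt_foldedKernel {q : ℝ → ℝ} (hq : ContDiff ℝ ∞ q) (x y : ℝ) :
    HasDerivAt (foldedKernel q x)
      (-deriv q (x - y) + deriv q (x + y) + deriv q (x + y - 2)) y := by
  have h : ∀ z, HasDerivAt q (deriv q z) z := fun z => (hq.differentiable (by simp) z).hasDerivAt
  have h2 : HasDerivAt (fun y => q (x + y - 2)) (deriv q (x + y - 2)) y := by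
    have := (h (x + y - 2)).comp y (((hasDerivAt_id y).const_add x).sub_const 2)
    rwa [mul_one] at this
  exact (((h (x - y)).comp_const_sub x y).add ((h (x + y)).comp_const_add x y)).add h2

/-- Two derivatives in y undo the sign from x - y. So the second derivative on the test function in
the weak form is the second x-derivative of the mollified solution. -/
theorem deriv_deriv_foldedKernel {q : ℝ → ℝ} (hq : ContDiff ℝ ∞ q) (x : ℝ) :
    deriv (deriv (foldedKernel q x)) = foldedKernel (deriv (deriv q)) x := by
  have h1 : deriv (foldedKernel q x) =
      fun y => -deriv q (x - y) + deriv q (x + y) + deriv q (x + y - 2) :=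
    funext fun y => (hasDerivAt_foldedKernel hq x y).deriv
  have hq' := contDiff_deriv_infty hq
  have h : ∀ z, HasDerivAt (deriv q) (deriv (deriv q) z) z :=
    fun z => (hq'.differentiable (by simp) z).hasDerivAt
  rw [h1]
  funext y
  have h2 : HasDerivAt (fun y => deriv q (x + y - 2)) (deriv (deriv q) (x + y - 2)) y := by
    have := (h (x + y - 2)).comp y (((hasDerivAt_id y).const_add x).sub_const 2)
    rwa [mul_one] at this
  have := ((((h (x - y)).comp_const_sub x y).neg).add ((h (x + y)).comp_const_add x y)).add h2
  rw [neg_neg] at this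
  exact this.deriv

namespace IsMollifier

variable {ε : ℝ} {ρ : ℝ → ℝ}

theorem deriv_eq_zero (h : IsMollifier ε ρ) {z : ℝ} (hz : ε < |z|) : deriv ρ z = 0 := by
  have : ρ =ᶠ[nhds z] fun _ => 0 := by
    filter_upwards [continuous_abs.continuousAt.eventually (lt_mem_nhds hz)] with y hy
    exact h.eq_zero y hy.le
  rw [this.deriv_eq, deriv_const]

/-- At y = 0 the derivatives of the first two terms cancel and the third is out of range; this is
half of the Neumann condition on test functions. -/
theorem deriv_foldedKernel_zero (h : IsMollifier ε ρ) (hε : ε ≤ 1 / 2) {x : ℝ}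
    (hx : x ∈ Icc (0 : ℝ) 1) : deriv (foldedKernel ρ x) 0 = 0 := by
  rw [(hasDerivAt_foldedKernel h.contDiff x 0).deriv,
    h.deriv_eq_zero (z := x + 0 - 2) (by rw [lt_abs]; right; linarith [hx.2])]
  simp

theorem deriv_foldedKernel_one (h : IsMollifier ε ρ) (hε : ε ≤ 1 / 2) {x : ℝ}
    (hx : x ∈ Icc (0 : ℝ) 1) : deriv (foldedKernel ρ x) 1 = 0 := by
  rw [(hasDerivAt_foldedKernel h.contDiff x 1).deriv,
    h.deriv_eq_zero (z := x + 1) (by rw [lt_abs]; left; linarith [hx.1]),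
    show x + 1 - 2 = x - 1 by ring]
  simp

theorem foldedKernel_nonneg (h : IsMollifier ε ρ) (x y : ℝ) : 0 ≤ foldedKernel ρ x y :=
  add_nonneg (add_nonneg (h.nonneg _) (h.nonneg _)) (h.nonneg _)

theorem foldedKernel_eq_zero (h : IsMollifier ε ρ) {x y : ℝ} (hx : x ∈ Icc (0 : ℝ) 1)
    (hy : y ∈ Icc (0 : ℝ) 1) (hxy : ε ≤ |x - y|) : foldedKernel ρ x y = 0 := by
  obtain ⟨hx0, hx1⟩ := hx
  obtain ⟨hy0, hy1⟩ := hy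
  have h1 : |x - y| ≤ |x + y| := by
    rw [abs_of_nonneg (by linarith : 0 ≤ x + y), abs_le]; constructor <;> linarith
  have h2 : |x - y| ≤ |x + y - 2| := by
    rw [abs_of_nonpos (by linarith : x + y - 2 ≤ 0), abs_le]; constructor <;> linarith
  unfold foldedKernel
  rw [h.eq_zero _ hxy, h.eq_zero _ (hxy.trans h1), h.eq_zero _ (hxy.trans h2)]
  simp

/-- The three terms are integrals of ρ over adjacent intervals filling [x - 2, x + 1], which
contains the support of ρ. -/
theorem integral_foldedKernel (h : IsMollifier ε ρ) (hε : ε ≤ 1 / 2) {x : ℝ}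
    (hx : x ∈ Icc (0 : ℝ) 1) : ∫ y in (0 : ℝ)..1, foldedKernel ρ x y = 1 := by
  have hc := h.contDiff.continuous
  have hi : ∀ a b, IntervalIntegrable ρ volume a b := fun a b => hc.intervalIntegrable a b
  have e1 : ∫ y in (0 : ℝ)..1, ρ (x - y) = ∫ z in (x - 1)..x, ρ z := by
    rw [intervalIntegral.integral_comp_sub_left (fun z => ρ z) x]; simp
  have e2 : ∫ y in (0 : ℝ)..1, ρ (x + y) = ∫ z in x..(x + 1), ρ z := by
    rw [intervalIntegral.integral_comp_add_left (fun z => ρ z) x]; simp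
  have e3 : ∫ y in (0 : ℝ)..1, ρ (x + y - 2) = ∫ z in (x - 2)..(x - 1), ρ z := by
    have : (fun y => ρ (x + y - 2)) = fun y => ρ ((x - 2) + y) := by
      funext y; congr 1; ring
    rw [this, intervalIntegral.integral_comp_add_left (fun z => ρ z) (x - 2)]
    congr 1 <;> ring
  unfold foldedKernel
  rw [intervalIntegral.integral_add, intervalIntegral.integral_add, e1, e2, e3,
    intervalIntegral.integral_add_adjacent_intervals (hi _ _) (hi _ _), add_comm,
    intervalIntegral.integral_add_adjacent_intervals (hi _ _) (hi _ _),
    intervalIntegral.integral_of_le (by linarith [hx.1])]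
  · refine Eq.trans (setIntegral_eq_integral_of_forall_compl_eq_zero fun z hz =>
      h.eq_zero z ?_) h.integral_eq_one
    by_contra! hlt
    rw [abs_lt] at hlt
    exact hz ⟨by linarith [hx.2], by linarith [hx.1]⟩
  all_goals exact Continuous.intervalIntegrable (by fun_prop) _ _

/-- A mollification is symmetric with respect to both ends of the interval. -/
theorem foldedKernel_reflect_zero (h : IsMollifier ε ρ) (hε : ε ≤ 1 / 2) {x y : ℝ}
    (hx : x ∈ Icc (0 : ℝ) (1 / 2)) (hy : y ∈ Icc (0 : ℝ) 1) :
    foldedKernel ρ (-x) y = foldedKernel ρ x y := by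
  unfold foldedKernel
  rw [h.eq_zero (-x + y - 2) (by rw [le_abs]; right; linarith [hx.1, hy.2]),
    h.eq_zero (x + y - 2) (by rw [le_abs]; right; linarith [hx.2, hy.2]),
    show -x - y = -(x + y) by ring, show -x + y = -(x - y) by ring, h.even, h.even]
  ring

theorem foldedKernel_reflect_one (h : IsMollifier ε ρ) (hε : ε ≤ 1 / 2) {x y : ℝ}
    (hx : x ∈ Icc (1 / 2 : ℝ) 1) (hy : y ∈ Icc (0 : ℝ) 1) :
    foldedKernel ρ (2 - x) y = foldedKernel ρ x y := by
  unfold foldedKernel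
  rw [h.eq_zero (2 - x + y) (by rw [le_abs]; left; linarith [hx.2, hy.1]),
    h.eq_zero (x + y) (by rw [le_abs]; left; linarith [hx.1, hy.1]),
    show 2 - x - y = -(x + y - 2) by ring, show 2 - x + y - 2 = -(x - y) by ring, h.even, h.even]
  ring

/-- At a maximum over `[0,1]`, the second derivative of a mollification is nonpositive. -/
theorem integral_second_deriv_nonpos (h : IsMollifier ε ρ) (hε : ε ≤ 1 / 2) {r : ℝ → ℝ}
    (hr : ContinuousOn r (Icc 0 1)) {x₀ : ℝ} (hx₀ : x₀ ∈ Icc (0 : ℝ) 1)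
    (hmax : ∀ x ∈ Icc (0 : ℝ) 1, ∫ y in (0 : ℝ)..1, r y * foldedKernel ρ x y ≤
      ∫ y in (0 : ℝ)..1, r y * foldedKernel ρ x₀ y) :
    ∫ y in (0 : ℝ)..1, r y * foldedKernel (deriv (deriv ρ)) x₀ y ≤ 0 := by
  set F : ℝ → ℝ := fun x => ∫ y in (0 : ℝ)..1, r y * foldedKernel ρ x y with hF
  have hd1 : deriv F = fun x => ∫ y in (0 : ℝ)..1, r y * foldedKernel (deriv ρ) x y :=
    funext fun x => (hasDerivAt_integral_foldedKernel h.contDiff h.hasCompactSupport hr x).deriv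
  have hd2 : deriv (deriv F) =
      fun x => ∫ y in (0 : ℝ)..1, r y * foldedKernel (deriv (deriv ρ)) x y := by
    rw [hd1]
    exact funext fun x => (hasDerivAt_integral_foldedKernel (contDiff_deriv_infty h.contDiff)
      h.hasCompactSupport.deriv hr x).deriv
  have hcongr : ∀ x x', (∀ y ∈ Icc (0 : ℝ) 1, foldedKernel ρ x' y = foldedKernel ρ x y) →
      F x' = F x := fun x x' hxx => by
    refine intervalIntegral.integral_congr fun y hy => ?_
    rw [uIcc_of_le zero_le_one] at hy
    simp only [hxx y hy]
  -- F is even about 0 and about 1 (locally), so a maximum over [0,1] attained at an endpoint is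
  -- still a two-sided local maximum.
  have hloc : IsLocalMax F x₀ := by
    have hnhds : Ioo (-(1 / 2) : ℝ) (3 / 2) ∈ nhds x₀ :=
      Ioo_mem_nhds (by linarith [hx₀.1]) (by linarith [hx₀.2])
    filter_upwards [hnhds] with x hx
    rcases lt_or_ge x 0 with h0 | h0
    · have h1 : -x ∈ Icc (0 : ℝ) (1 / 2) := ⟨by linarith, by linarith [hx.1]⟩
      have := hcongr (-x) x fun y hy => by
        simpa using h.foldedKernel_reflect_zero hε h1 hy
      rw [this]
      exact hmax _ ⟨h1.1, by linarith [h1.2]⟩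
    · rcases le_or_gt x 1 with h2 | h2
      · exact hmax x ⟨h0, h2⟩
      · have h1 : 2 - x ∈ Icc (1 / 2 : ℝ) 1 := ⟨by linarith [hx.2], by linarith⟩
        have := hcongr (2 - x) x fun y hy => by
          simpa using h.foldedKernel_reflect_one hε h1 hy
        rw [this]
        exact hmax _ ⟨by linarith [h1.1], h1.2⟩
  by_contra! hpos
  have hpos' : deriv (deriv F) x₀ > 0 := by rw [hd2]; exact hpos
  have hcont : ContinuousAt F x₀ :=
    (hasDerivAt_integral_foldedKernel h.contDiff h.hasCompactSupport hr x₀).continuousAt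
  -- A positive second derivative would make x₀ a local minimum as well, so F would be constant near
  -- x₀ and its second derivative zero.
  have hmin := isLocalMin_of_deriv_deriv_pos hpos' hloc.deriv_eq_zero hcont
  have hconst : F =ᶠ[nhds x₀] fun _ => F x₀ := by
    filter_upwards [hloc, hmin] with x h1 h2 using le_antisymm h1 h2
  have hz : deriv F =ᶠ[nhds x₀] fun _ => 0 := by
    have := hconst.deriv
    simpa using this
  rw [hz.deriv_eq, deriv_const] at hpos'
  exact lt_irrefl _ hpos'

end IsMollifier

/-! ### Space-time integrals and weak solutions. -/

theorem measurableSet_rect (t : ℝ) : MeasurableSet (rect t) :=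
  measurableSet_Icc.prod measurableSet_Icc

theorem isCompact_rect (t : ℝ) : IsCompact (rect t) := isCompact_Icc.prod isCompact_Icc

theorem isFiniteMeasure_volume_restrict_rect (S : ℝ) :
    IsFiniteMeasure ((volume : Measure (ℝ × ℝ)).restrict (rect S)) :=
  ⟨by simpa using (isCompact_rect S).measure_lt_top⟩

theorem rect_subset_rect {s t : ℝ} (h : s ≤ t) : rect s ⊆ rect t :=
  prod_mono subset_rfl (Icc_subset_Icc_right h)

theorem volume_restrict_rect (t : ℝ) : (volume : Measure (ℝ × ℝ)).restrict (rect t) =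
    ((volume : Measure ℝ).restrict (Icc 0 1)).prod ((volume : Measure ℝ).restrict (Icc 0 t)) := by
  rw [Measure.prod_restrict, rect, Measure.volume_eq_prod]

theorem integral_rect_eq {g : ℝ × ℝ → ℝ} {t : ℝ} (ht : 0 ≤ t) (hg : IntegrableOn g (rect t)) :
    ∫ p in rect t, g p = ∫ s in (0 : ℝ)..t, ∫ x in (0 : ℝ)..1, g (x, s) := by
  unfold IntegrableOn at hg
  rw [volume_restrict_rect] at hg ⊢
  rw [integral_prod_symm _ hg, intervalIntegral.integral_of_le ht, integral_Icc_eq_integral_Ioc]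
  refine integral_congr_ae (Filter.Eventually.of_forall fun s => ?_)
  simp only
  rw [intervalIntegral.integral_of_le zero_le_one, integral_Icc_eq_integral_Ioc]

theorem intervalIntegrable_integral_rect {g : ℝ × ℝ → ℝ} {t : ℝ} (ht : 0 ≤ t)
    (hg : IntegrableOn g (rect t)) :
    IntervalIntegrable (fun s => ∫ x in (0 : ℝ)..1, g (x, s)) volume 0 t := by
  unfold IntegrableOn at hg
  rw [volume_restrict_rect] at hg
  have := hg.integral_prod_right
  rw [intervalIntegrable_iff_integrableOn_Icc_of_le ht]
  refine this.congr (Filter.Eventually.of_forall fun s => ?_)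
  simp only
  rw [intervalIntegral.integral_of_le zero_le_one, integral_Icc_eq_integral_Ioc]

theorem continuousOn_integral_rect {g : ℝ × ℝ → ℝ} {S : ℝ} (hS : 0 ≤ S)
    (hg : IntegrableOn g (rect S)) :
    ContinuousOn (fun t => ∫ p in rect t, g p) (Icc 0 S) := by
  have h := intervalIntegral.continuousOn_primitive_interval'
    (intervalIntegrable_integral_rect hS hg) left_mem_uIcc
  rw [uIcc_of_le hS] at h
  exact h.congr fun t ht => integral_rect_eq ht.1 (hg.mono_set (rect_subset_rect ht.2))

/-- `w` is a weak solution of `∂w/∂t = ∂²w/∂x² + a + μ - ν` with Neumann boundary conditions. -/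
def IsWeakSolution (S : ℝ) (w : ℝ → ℝ → ℝ) (a : ℝ × ℝ → ℝ) (μ ν : Measure (ℝ × ℝ)) : Prop :=
  ∀ t ∈ Icc (0 : ℝ) S, ∀ φ : ℝ → ℝ, ContDiff ℝ ∞ φ → deriv φ 0 = 0 → deriv φ 1 = 0 →
    ∫ x in (0 : ℝ)..1, w x t * φ x =
      (∫ x in (0 : ℝ)..1, w x 0 * φ x) + (∫ p in rect t, w p.1 p.2 * deriv (deriv φ) p.1)
        + (∫ p in rect t, a p * φ p.1) + (∫ p in rect t, φ p.1 ∂μ) - ∫ p in rect t, φ p.1 ∂ν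

theorem continuousOn_slice {r : ℝ → ℝ → ℝ} {S : ℝ} (hr : ContinuousOn (Function.uncurry r) (rect S))
    {t : ℝ} (ht : t ∈ Icc (0 : ℝ) S) : ContinuousOn (fun x => r x t) (Icc 0 1) :=
  hr.comp (f := fun x => (x, t)) (by fun_prop) fun _ hx => ⟨hx, ht⟩

theorem continuousOn_integral_mul_foldedKernel {r : ℝ → ℝ → ℝ} {S : ℝ} {q : ℝ → ℝ} (hS : 0 ≤ S)
    (hr : ContinuousOn (Function.uncurry r) (rect S)) (hq : Continuous q) :
    ContinuousOn (fun p : ℝ × ℝ => ∫ y in (0 : ℝ)..1, r y p.2 * foldedKernel q p.1 y)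
      (rect S) := by
  -- Clamping both variables extends r continuously to the plane, so that the parametric integral is
  -- continuous everywhere.
  let c : ℝ → ℝ → ℝ := fun a y => max 0 (min y a)
  have hmem : ∀ a, 0 ≤ a → ∀ y, c a y ∈ Icc 0 a := fun a ha y =>
    ⟨le_max_left _ _, max_le ha (min_le_right _ _)⟩
  have hid : ∀ a y, y ∈ Icc 0 a → c a y = y := fun a y hy => by
    simp only [c, min_eq_left hy.2, max_eq_right hy.1]
  have hext : Continuous fun z : (ℝ × ℝ) => r (c 1 z.1) (c S z.2) := by
    rw [← continuousOn_univ]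
    exact hr.comp (f := fun z : ℝ × ℝ => (c 1 z.1, c S z.2)) (by fun_prop)
      fun z _ => ⟨hmem 1 zero_le_one _, hmem S hS _⟩
  have hK := continuous_uncurry_foldedKernel hq
  have hcont : Continuous fun p : ℝ × ℝ =>
      ∫ y in (0 : ℝ)..1, r (c 1 y) (c S p.2) * foldedKernel q p.1 y := by
    apply intervalIntegral.continuous_parametric_intervalIntegral_of_continuous'
    have h1 := hext.comp (f := fun z : (ℝ × ℝ) × ℝ => (z.2, z.1.2)) (by fun_prop)
    have h2 := hK.comp (f := fun z : (ℝ × ℝ) × ℝ => (z.1.1, z.2)) (by fun_prop)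
    exact h1.mul h2
  refine hcont.continuousOn.congr fun p hp => ?_
  refine intervalIntegral.integral_congr fun y hy => ?_
  rw [uIcc_of_le zero_le_one] at hy
  simp only [hid 1 y hy, hid S p.2 hp.2]

/-! ### The maximum principle. -/

/-- On [0,1] the folded kernel is a probability density supported in the ε-window of x, so this is
an average over that window. -/
theorem IsMollifier.integral_le {ε c : ℝ} {ρ r : ℝ → ℝ} (h : IsMollifier ε ρ) (hε : ε ≤ 1 / 2)
    (hr : ContinuousOn r (Icc 0 1)) {x : ℝ} (hx : x ∈ Icc (0 : ℝ) 1)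
    (hc : ∀ y ∈ Icc (0 : ℝ) 1, |x - y| < ε → r y ≤ c) :
    ∫ y in (0 : ℝ)..1, r y * foldedKernel ρ x y ≤ c := by
  have hK := continuous_foldedKernel h.contDiff.continuous x
  calc ∫ y in (0 : ℝ)..1, r y * foldedKernel ρ x y
      ≤ ∫ y in (0 : ℝ)..1, c * foldedKernel ρ x y := by
        refine intervalIntegral.integral_mono_on zero_le_one ?_ ?_ fun y hy => ?_
        · refine ContinuousOn.intervalIntegrable ?_
          rw [uIcc_of_le zero_le_one]
          exact hr.mul hK.continuousOn
        · exact (continuous_const.mul hK).intervalIntegrable _ _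
        · rcases lt_or_ge |x - y| ε with hlt | hge
          · exact mul_le_mul_of_nonneg_right (hc y hy hlt) (h.foldedKernel_nonneg x y)
          · rw [h.foldedKernel_eq_zero hx hy hge]; simp
    _ = c := by
        rw [intervalIntegral.integral_const_mul, h.integral_foldedKernel hε hx, mul_one]

theorem IsMollifier.le_integral {ε c : ℝ} {ρ r : ℝ → ℝ} (h : IsMollifier ε ρ) (hε : ε ≤ 1 / 2)
    (hr : ContinuousOn r (Icc 0 1)) {x : ℝ} (hx : x ∈ Icc (0 : ℝ) 1)
    (hc : ∀ y ∈ Icc (0 : ℝ) 1, |x - y| < ε → c ≤ r y) :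
    c ≤ ∫ y in (0 : ℝ)..1, r y * foldedKernel ρ x y := by
  have := h.integral_le hε hr.neg hx (c := -c) fun y hy hxy => neg_le_neg (hc y hy hxy)
  simp only [Pi.neg_apply, neg_mul, intervalIntegral.integral_neg] at this
  linarith

/-- The increment of a mollified weak solution over a time interval on which the upward
reflection does not act near `x`. -/
theorem IsWeakSolution.mollify_sub_le {S : ℝ} {r : ℝ → ℝ → ℝ} {b : ℝ × ℝ → ℝ}
    {μ ν : Measure (ℝ × ℝ)} [IsFiniteMeasure μ] [IsFiniteMeasure ν]
    (hsol : IsWeakSolution S r b μ ν) (hr : ContinuousOn (Function.uncurry r) (rect S))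
    (hb : IntegrableOn b (rect S)) {ε M γ : ℝ} {ρ : ℝ → ℝ} (h : IsMollifier ε ρ) (hε : ε ≤ 1 / 2)
    (hM : ∀ z, |ρ z| ≤ M) {x s t : ℝ} (hx : x ∈ Icc (0 : ℝ) 1) (hs : 0 ≤ s) (hst : s ≤ t)
    (ht : t ≤ S)
    (hγ : ∀ τ ∈ Icc s t, ∫ y in (0 : ℝ)..1, r y τ * foldedKernel (deriv (deriv ρ)) x y ≤ γ)
    (hμ : μ {p ∈ rect t \ rect s | |x - p.1| < ε} = 0) :
    (∫ y in (0 : ℝ)..1, r y t * foldedKernel ρ x y) -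
        (∫ y in (0 : ℝ)..1, r y s * foldedKernel ρ x y) ≤
      γ * (t - s) + 3 * M * ((∫ p in rect t, |b p|) - ∫ p in rect s, |b p|) := by
  have hρc := h.contDiff.continuous
  have hKc := continuous_foldedKernel hρc x
  have hK1 : Continuous fun p : ℝ × ℝ => foldedKernel ρ x p.1 := hKc.comp continuous_fst
  have hdiff : ∀ (θ : Measure (ℝ × ℝ)) (g : ℝ × ℝ → ℝ), IntegrableOn g (rect t) θ →
      (∫ p in rect t, g p ∂θ) - (∫ p in rect s, g p ∂θ) = ∫ p in rect t \ rect s, g p ∂θ :=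
    fun θ g hg => (setIntegral_sdiff (measurableSet_rect s) hg (rect_subset_rect hst)).symm
  have hbt : IntegrableOn b (rect t) := hb.mono_set (rect_subset_rect ht)
  have hbK : ∀ p, |b p * foldedKernel ρ x p.1| ≤ 3 * M * |b p| := fun p => by
    rw [abs_mul, mul_comm]
    exact mul_le_mul_of_nonneg_right (abs_foldedKernel_le hM x p.1) (abs_nonneg _)
  have hbKi : IntegrableOn (fun p => b p * foldedKernel ρ x p.1) (rect t) :=
    (hbt.abs.const_mul (3 * M)).mono' (hbt.aestronglyMeasurable.mul hK1.aestronglyMeasurable)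
      (Filter.Eventually.of_forall hbK)
  have hKμ : ∀ (θ : Measure (ℝ × ℝ)) [IsFiniteMeasure θ],
      IntegrableOn (fun p : ℝ × ℝ => foldedKernel ρ x p.1) (rect t) θ := fun θ _ =>
    hK1.continuousOn.integrableOn_compact (isCompact_rect t)
  have hwt := hsol t ⟨hs.trans hst, ht⟩ (foldedKernel ρ x) (contDiff_foldedKernel h.contDiff x)
    (h.deriv_foldedKernel_zero hε hx) (h.deriv_foldedKernel_one hε hx)
  have hws := hsol s ⟨hs, hst.trans ht⟩ (foldedKernel ρ x) (contDiff_foldedKernel h.contDiff x)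
    (h.deriv_foldedKernel_zero hε hx) (h.deriv_foldedKernel_one hε hx)
  rw [deriv_deriv_foldedKernel h.contDiff x] at hwt hws
  have hρ2 : ContDiff ℝ ∞ (deriv (deriv ρ)) := contDiff_deriv_infty (contDiff_deriv_infty h.contDiff)
  have hint2 : IntegrableOn (fun p : ℝ × ℝ => r p.1 p.2 * foldedKernel (deriv (deriv ρ)) x p.1)
      (rect S) := by
    refine ContinuousOn.integrableOn_compact (isCompact_rect S) ?_
    exact hr.mul ((continuous_foldedKernel hρ2.continuous x).comp continuous_fst).continuousOn
  have hS : 0 ≤ S := hs.trans (hst.trans ht)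
  have e2 : (∫ p in rect t, r p.1 p.2 * foldedKernel (deriv (deriv ρ)) x p.1) -
      (∫ p in rect s, r p.1 p.2 * foldedKernel (deriv (deriv ρ)) x p.1) ≤ γ * (t - s) := by
    rw [integral_rect_eq (hs.trans hst) (hint2.mono_set (rect_subset_rect ht)),
      integral_rect_eq hs (hint2.mono_set (rect_subset_rect (hst.trans ht)))]
    have hii := intervalIntegrable_integral_rect hS hint2
    have hsub : ∀ a c, a ∈ Icc 0 S → c ∈ Icc 0 S →
        IntervalIntegrable (fun τ => ∫ y in (0 : ℝ)..1,
          r y τ * foldedKernel (deriv (deriv ρ)) x y) volume a c := fun a c ha hc =>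
      hii.mono_set (by rw [uIcc_of_le hS]; exact uIcc_subset_Icc ha hc)
    rw [intervalIntegral.integral_interval_sub_left
      (hsub 0 t ⟨le_rfl, hS⟩ ⟨hs.trans hst, ht⟩) (hsub 0 s ⟨le_rfl, hS⟩ ⟨hs, hst.trans ht⟩)]
    calc _ ≤ ∫ _ in s..t, γ := intervalIntegral.integral_mono_on hst
          (hsub s t ⟨hs, hst.trans ht⟩ ⟨hs.trans hst, ht⟩) (by simp) hγ
      _ = γ * (t - s) := by simp [mul_comm]
  have e3 : (∫ p in rect t, b p * foldedKernel ρ x p.1) -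
      (∫ p in rect s, b p * foldedKernel ρ x p.1) ≤
        3 * M * ((∫ p in rect t, |b p|) - ∫ p in rect s, |b p|) := by
    rw [hdiff _ _ hbKi, hdiff _ _ hbt.abs, ← integral_const_mul]
    have hbi : IntegrableOn (fun p => 3 * M * |b p|) (rect t) := hbt.abs.const_mul _
    exact setIntegral_mono_on (hbKi.mono_set sdiff_subset) (hbi.mono_set sdiff_subset)
      ((measurableSet_rect t).diff (measurableSet_rect s)) fun p _ => (le_abs_self _).trans (hbK p)
  have e4 : (∫ p in rect t, foldedKernel ρ x p.1 ∂μ) -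
      (∫ p in rect s, foldedKernel ρ x p.1 ∂μ) = 0 := by
    rw [hdiff _ _ (hKμ μ)]
    refine setIntegral_eq_zero_of_ae_eq_zero ?_
    filter_upwards [measure_eq_zero_iff_ae_notMem.1 hμ] with p hp hpm
    refine h.foldedKernel_eq_zero hx hpm.1.1 ?_
    by_contra! hlt
    exact hp ⟨hpm, hlt⟩
  -- The downward reflection has a favourable sign and is dropped.
  have e5 : 0 ≤ (∫ p in rect t, foldedKernel ρ x p.1 ∂ν) -
      (∫ p in rect s, foldedKernel ρ x p.1 ∂ν) := by
    rw [hdiff _ _ (hKμ ν)]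
    exact integral_nonneg fun p => h.foldedKernel_nonneg x p.1
  linarith

/-- A weak maximum principle for weak solutions with reflection. -/
theorem exists_upper_bound_of_isWeakSolution {S : ℝ} (hS : 0 ≤ S) {w : ℝ → ℝ → ℝ}
    (hw : ContinuousOn (Function.uncurry w) (rect S)) {μ ν : Measure (ℝ × ℝ)}
    [IsFiniteMeasure μ] [IsFiniteMeasure ν] (hμ : μ {p ∈ rect S | 0 < w p.1 p.2} = 0)
    {ε : ℝ} (hε : 0 < ε) :
    ∃ M, 0 ≤ M ∧ ∀ (V : ℝ → ℝ → ℝ) (b : ℝ × ℝ → ℝ) (c : ℝ),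
      ContinuousOn (Function.uncurry V) (rect S) →
      (∀ p ∈ rect S, 0 ≤ V p.1 p.2 ∧ V p.1 p.2 ≤ c) →
      (∀ x ∈ Icc (0 : ℝ) 1, w x 0 ≤ V x 0) → IntegrableOn b (rect S) →
      IsWeakSolution S (fun x t => w x t - V x t) b μ ν →
      ∀ p ∈ rect S, w p.1 p.2 ≤ c + ε + M * ∫ p in rect S, |b p| := by
  -- The scale, and with it M, comes from the modulus of continuity of w alone; V and b may be
  -- chosen afterwards.
  obtain ⟨δ, hδ, hosc⟩ := Metric.uniformContinuousOn_iff.1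
    ((isCompact_rect S).uniformContinuousOn_of_continuous hw) (ε / 2) (by linarith)
  set e : ℝ := min (δ / 2) (1 / 2) with he
  have he2 : e ≤ 1 / 2 := min_le_right _ _
  have heδ : 2 * e ≤ δ := by linarith [min_le_left (δ / 2) (1 / 2 : ℝ)]
  have he0 : 0 < e := lt_min (by linarith) (by norm_num)
  obtain ⟨ρ, h⟩ := exists_isMollifier he0
  obtain ⟨M, hM0, hM⟩ := exists_abs_le_of_hasCompactSupport h.contDiff.continuous h.hasCompactSupport
  have hosc' : ∀ t ∈ Icc 0 S, ∀ y ∈ Icc (0 : ℝ) 1, ∀ y' ∈ Icc (0 : ℝ) 1, |y - y'| < 2 * e →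
      |w y t - w y' t| < ε / 2 := fun t ht y hy y' hy' hyy => by
    refine hosc (y, t) ⟨hy, ht⟩ (y', t) ⟨hy', ht⟩ ?_
    simpa [Prod.dist_eq, Real.dist_eq] using hyy.trans_le heδ
  refine ⟨3 * M, by linarith, fun V b c hV hVb hV0 hb hsol => ?_⟩
  set r : ℝ → ℝ → ℝ := fun x t => w x t - V x t with hrdef
  have hr : ContinuousOn (Function.uncurry r) (rect S) := hw.sub hV
  set R : ℝ × ℝ → ℝ := fun p => ∫ y in (0 : ℝ)..1, r y p.2 * foldedKernel ρ p.1 y with hR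
  set D : ℝ → ℝ := fun t => ∫ p in rect t, |b p| with hD
  have hRc : ContinuousOn R (rect S) :=
    continuousOn_integral_mul_foldedKernel hS hr h.contDiff.continuous
  have hDc : ContinuousOn D (Icc 0 S) := continuousOn_integral_rect hS hb.abs
  have hD0 : ∀ t, 0 ≤ D t := fun t => integral_nonneg fun p => abs_nonneg _
  have hDm : ∀ t ≤ S, D t ≤ D S := fun t ht =>
    setIntegral_mono_set hb.abs (Filter.Eventually.of_forall fun p => abs_nonneg _)
      (rect_subset_rect ht).eventuallyLE
  have key : ∀ γ > 0, ∀ p ∈ rect S, R p ≤ ε / 2 + 3 * M * D S + γ * S := by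
    intro γ hγ
    -- The term with D absorbs the forcing b, and the slope γ makes the final contradiction strict.
    set G : ℝ × ℝ → ℝ := fun p => R p - 3 * M * D p.2 - γ * p.2 with hG
    have hGc : ContinuousOn G (rect S) := by
      refine (hRc.sub ((hDc.comp continuousOn_snd fun p hp => hp.2).const_mul _)).sub ?_
      fun_prop
    obtain ⟨⟨x₀, t₀⟩, ⟨hx₀, ht₀⟩, hmax⟩ := (isCompact_rect S).exists_isMaxOn
      (⟨(0, 0), ⟨by simp, by simpa using hS⟩⟩ : (rect S).Nonempty) hGc
    simp only at hx₀ ht₀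
    have hmax' : ∀ x ∈ Icc (0 : ℝ) 1, ∀ t ∈ Icc 0 S, G (x, t) ≤ G (x₀, t₀) :=
      fun x hx t ht => hmax (show (x, t) ∈ rect S from ⟨hx, ht⟩)
    suffices hle : G (x₀, t₀) ≤ ε / 2 by
      rintro ⟨x, t⟩ ⟨hx, ht⟩
      have h1 := (hmax' x hx t ht).trans hle
      simp only [hG] at h1
      have h2 := mul_le_mul_of_nonneg_left (hDm t ht.2) (by linarith : 0 ≤ 3 * M)
      have h3 := mul_le_mul_of_nonneg_left ht.2 hγ.le
      simp only at h3
      linarith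
    by_contra! hgt
    have hRgt : ε / 2 < R (x₀, t₀) := by
      simp only [hG] at hgt
      have h1 := mul_nonneg (by linarith : 0 ≤ 3 * M) (hD0 t₀)
      have h2 := mul_nonneg hγ.le ht₀.1
      linarith
    have ht₀pos : 0 < t₀ := by
      refine lt_of_le_of_ne ht₀.1 fun h0 => ?_
      subst h0
      have : R (x₀, 0) ≤ 0 := h.integral_le he2 (continuousOn_slice hr ht₀) hx₀ fun y hy _ => by
        simp only [hrdef]
        linarith [hV0 y hy]
      linarith
    have hsecond : ∫ y in (0 : ℝ)..1, r y t₀ * foldedKernel (deriv (deriv ρ)) x₀ y ≤ 0 := by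
      refine h.integral_second_deriv_nonpos he2 (continuousOn_slice hr ht₀) hx₀ fun x hx => ?_
      have := hmax' x hx t₀ ht₀
      simp only [hG, hR] at this
      linarith
    have hρ2 : ContDiff ℝ ∞ (deriv (deriv ρ)) :=
      contDiff_deriv_infty (contDiff_deriv_infty h.contDiff)
    have hmaps : MapsTo (fun s : ℝ => (x₀, s)) (Icc 0 S) (rect S) := fun s hs => ⟨hx₀, hs⟩
    have hc1 : ContinuousOn (fun s => R (x₀, s)) (Icc 0 S) := hRc.comp (by fun_prop) hmaps
    have hc2 : ContinuousOn (fun s => ∫ y in (0 : ℝ)..1,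
        r y s * foldedKernel (deriv (deriv ρ)) x₀ y) (Icc 0 S) :=
      (continuousOn_integral_mul_foldedKernel hS hr hρ2.continuous).comp
        (f := fun s : ℝ => (x₀, s)) (by fun_prop) hmaps
    have hev := ((hc1 t₀ ht₀).eventually (lt_mem_nhds hRgt)).and
      ((hc2 t₀ ht₀).eventually (gt_mem_nhds (hsecond.trans_lt (half_pos hγ))))
    obtain ⟨κ, hκ, hball⟩ := Metric.mem_nhdsWithin_iff.1 hev
    set s₁ := max 0 (t₀ - κ / 2) with hs₁
    have hs₁0 : 0 ≤ s₁ := le_max_left _ _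
    have hs₁t : s₁ < t₀ := max_lt ht₀pos (by linarith)
    have hnear : ∀ τ ∈ Icc s₁ t₀, ε / 2 < R (x₀, τ) ∧
        ∫ y in (0 : ℝ)..1, r y τ * foldedKernel (deriv (deriv ρ)) x₀ y < γ / 2 := fun τ hτ => by
      refine hball ⟨?_, hs₁0.trans hτ.1, hτ.2.trans ht₀.2⟩
      rw [Metric.mem_ball, Real.dist_eq, abs_lt]
      have := (le_max_right 0 (t₀ - κ / 2)).trans hτ.1
      constructor <;> linarith [hτ.2]
    -- If w(y,τ) ≤ 0 somewhere in the window, then w < ε/2 throughout it by the choice of e, and V ≥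
    -- 0 gives R(x₀,τ) ≤ ε/2, which is excluded. So w > 0 there, where μ vanishes.
    have hμ0 : μ {p ∈ rect t₀ \ rect s₁ | |x₀ - p.1| < e} = 0 := by
      refine measure_mono_null ?_ hμ
      rintro ⟨y, τ⟩ ⟨⟨⟨hy, hτ⟩, hns⟩, hxy⟩
      simp only at hy hτ hxy
      have hτS : τ ∈ Icc 0 S := ⟨hτ.1, hτ.2.trans ht₀.2⟩
      have hτs : s₁ ≤ τ := by
        by_contra! hlt
        exact hns ⟨hy, hτ.1, hlt.le⟩
      refine ⟨⟨hy, hτS⟩, ?_⟩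
      simp only
      by_contra! hneg
      refine absurd (hnear τ ⟨hτs, hτ.2⟩).1 (not_lt.2 ?_)
      refine h.integral_le he2 (continuousOn_slice hr hτS) hx₀ fun y' hy' hxy' => ?_
      have h1 : |y' - y| < 2 * e := by
        rw [abs_lt] at hxy hxy' ⊢
        constructor <;> linarith
      have h2 := (abs_lt.1 (hosc' τ hτS y' hy' y hy h1)).2
      have h3 := (hVb (y', τ) ⟨hy', hτS⟩).1
      simp only [hrdef] at h3 ⊢
      linarith
    have hinc := hsol.mollify_sub_le hr hb h he2 hM hx₀ hs₁0 hs₁t.le ht₀.2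
      (fun τ hτ => (hnear τ hτ).2.le) hμ0
    -- Apart from the D term, R grows by at most (γ/2)(t₀ - s₁) on [s₁,t₀], while maximality of G at
    -- t₀ demands at least γ(t₀ - s₁).
    have hcmp := hmax' x₀ hx₀ s₁ ⟨hs₁0, hs₁t.le.trans ht₀.2⟩
    simp only [hG, hR, hD] at hcmp
    nlinarith [mul_pos hγ (sub_pos.2 hs₁t)]
  rintro ⟨x, t⟩ ⟨hx, ht⟩
  simp only at hx ht ⊢
  have hlow : w x t - c - ε / 2 ≤ R (x, t) := by
    refine h.le_integral he2 (continuousOn_slice hr ht) hx fun y hy hxy => ?_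
    have h2 := (abs_lt.1 (hosc' t ht x hx y hy (by linarith))).2
    have h3 := (hVb (y, t) ⟨hy, ht⟩).2
    simp only [hrdef] at h3 ⊢
    linarith
  refine le_of_forall_pos_le_add fun γ hγ => ?_
  have hk := key (γ / (S + 1)) (by positivity) (x, t) ⟨hx, ht⟩
  have : γ / (S + 1) * S ≤ γ := by
    rw [div_mul_eq_mul_div, div_le_iff₀ (by linarith)]
    nlinarith
  linarith

/-! ### Explicit heat solutions by cosine sums. -/

/-- A finite cosine sum in space with time-dependent coefficients. -/
noncomputable def cosSum (N : ℕ) (c : ℕ → ℝ → ℝ) (p : ℝ × ℝ) : ℝ :=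
  ∑ n ∈ Finset.range N, c n p.2 * Real.cos (n * Real.pi * p.1)

theorem continuous_cosSum {N : ℕ} {c : ℕ → ℝ → ℝ} (hc : ∀ n, Continuous (c n)) :
    Continuous (cosSum N c) :=
  continuous_finsetSum _ fun n _ => ((hc n).comp continuous_snd).mul (by fun_prop)

theorem integral_cos_int_mul_pi (k : ℤ) (hk : k ≠ 0) :
    ∫ x in (0 : ℝ)..1, Real.cos (k * Real.pi * x) = 0 := by
  have hne : (k : ℝ) * Real.pi ≠ 0 := mul_ne_zero (by exact_mod_cast hk) Real.pi_ne_zero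
  rw [intervalIntegral.integral_comp_mul_left (fun x => Real.cos x) hne]
  simp [integral_cos, Real.sin_int_mul_pi]

theorem integral_cos_mul_cos (n m : ℕ) :
    ∫ x in (0 : ℝ)..1, Real.cos (n * Real.pi * x) * Real.cos (m * Real.pi * x) =
      if n = m then (if n = 0 then 1 else 1 / 2) else 0 := by
  have hprod : ∀ x : ℝ, Real.cos (n * Real.pi * x) * Real.cos (m * Real.pi * x) =
      (Real.cos (((n : ℤ) - m : ℤ) * Real.pi * x) + Real.cos (((n : ℤ) + m : ℤ) * Real.pi * x)) / 2 := by
    intro x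
    push_cast
    rw [show ((n : ℝ) - m) * Real.pi * x = n * Real.pi * x - m * Real.pi * x by ring,
      show ((n : ℝ) + m) * Real.pi * x = n * Real.pi * x + m * Real.pi * x by ring,
      Real.cos_sub, Real.cos_add]
    ring
  simp_rw [hprod]
  rw [intervalIntegral.integral_div, intervalIntegral.integral_add
    (Continuous.intervalIntegrable (by fun_prop) _ _)
    (Continuous.intervalIntegrable (by fun_prop) _ _)]
  split_ifs with h1 h2
  · subst h1; subst h2; simp
  · subst h1
    rw [integral_cos_int_mul_pi (n + n : ℤ) (by omega)]
    simp
  · rw [integral_cos_int_mul_pi _ (by omega), integral_cos_int_mul_pi _ (by omega)]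
    simp

/-- Orthogonality; the factor 2 is needed because cos² has mean 1/2 for n ≥ 1. -/
theorem sum_sq_le_integral_sq (N : ℕ) (a : ℕ → ℝ) :
    ∑ n ∈ Finset.range N, a n ^ 2 ≤
      2 * ∫ x in (0 : ℝ)..1, (∑ n ∈ Finset.range N, a n * Real.cos (n * Real.pi * x)) ^ 2 := by
  have hexp : ∀ x : ℝ, (∑ n ∈ Finset.range N, a n * Real.cos (n * Real.pi * x)) ^ 2 =
      ∑ n ∈ Finset.range N, ∑ m ∈ Finset.range N,
        a n * a m * (Real.cos (n * Real.pi * x) * Real.cos (m * Real.pi * x)) := by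
    intro x
    rw [sq, Finset.sum_mul_sum]
    exact Finset.sum_congr rfl fun n _ => Finset.sum_congr rfl fun m _ => by ring
  have hint : ∫ x in (0 : ℝ)..1, (∑ n ∈ Finset.range N, a n * Real.cos (n * Real.pi * x)) ^ 2 =
      ∑ n ∈ Finset.range N, a n ^ 2 * (if n = 0 then 1 else 1 / 2) := by
    simp_rw [hexp]
    rw [intervalIntegral.integral_finsetSum fun n _ =>
      Continuous.intervalIntegrable (by fun_prop) _ _]
    refine Finset.sum_congr rfl fun n hn => ?_
    rw [intervalIntegral.integral_finsetSum fun m _ =>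
      Continuous.intervalIntegrable (by fun_prop) _ _]
    simp_rw [intervalIntegral.integral_const_mul, integral_cos_mul_cos]
    rw [Finset.sum_eq_single n]
    · simp only [if_true]; ring
    · intro m _ hm; simp [hm.symm]
    · intro h; exact absurd hn h
  rw [hint, Finset.mul_sum]
  refine Finset.sum_le_sum fun n _ => ?_
  split_ifs <;> nlinarith [sq_nonneg (a n)]

/-- Two integrations by parts; the boundary terms vanish because φ' = 0 and sin(nπx) = 0 at both
ends. -/
theorem integral_cos_mul_deriv_deriv (n : ℕ) {φ : ℝ → ℝ} (hφ : ContDiff ℝ ∞ φ)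
    (h0 : deriv φ 0 = 0) (h1 : deriv φ 1 = 0) :
    ∫ x in (0 : ℝ)..1, Real.cos (n * Real.pi * x) * deriv (deriv φ) x =
      -(n * Real.pi) ^ 2 * ∫ x in (0 : ℝ)..1, Real.cos (n * Real.pi * x) * φ x := by
  set k : ℝ := n * Real.pi with hk
  have hφ1 := contDiff_deriv_infty hφ
  have hφ2 := contDiff_deriv_infty hφ1
  have c0 := hφ.continuous
  have c2 := hφ2.continuous
  have hF : ∀ x ∈ uIcc (0 : ℝ) 1, HasDerivAt
      (fun x => Real.cos (k * x) * deriv φ x + k * Real.sin (k * x) * φ x)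
      (Real.cos (k * x) * deriv (deriv φ) x + k ^ 2 * (Real.cos (k * x) * φ x)) x := by
    intro x _
    have d0 : HasDerivAt φ (deriv φ x) x := (hφ.differentiable (by simp) x).hasDerivAt
    have d1 : HasDerivAt (deriv φ) (deriv (deriv φ) x) x :=
      (hφ1.differentiable (by simp) x).hasDerivAt
    have dk : HasDerivAt (fun x => k * x) k x := by simpa using (hasDerivAt_id x).const_mul k
    have := (dk.cos.mul d1).add ((dk.sin.const_mul k).mul d0)
    exact this.congr_deriv (by ring)
  have hi := intervalIntegral.integral_eq_sub_of_hasDerivAt hF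
    (Continuous.intervalIntegrable (by fun_prop) _ _)
  rw [intervalIntegral.integral_add (Continuous.intervalIntegrable (by fun_prop) _ _)
    (Continuous.intervalIntegrable (by fun_prop) _ _), intervalIntegral.integral_const_mul] at hi
  have hs : Real.sin (k * 1) = 0 := by rw [mul_one, hk]; exact Real.sin_nat_mul_pi n
  simp only [h0, h1, hs, mul_zero, Real.sin_zero, zero_mul, add_zero, sub_zero] at hi
  linarith

/-- The solution of `v' = -l v + c`, `v 0 = 0`. -/
noncomputable def duhamel (l : ℝ) (c : ℝ → ℝ) (t : ℝ) : ℝ :=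
  Real.exp (-l * t) * ∫ s in (0 : ℝ)..t, Real.exp (l * s) * c s

theorem hasDerivAt_duhamel {l : ℝ} {c : ℝ → ℝ} (hc : Continuous c) (t : ℝ) :
    HasDerivAt (duhamel l c) (-l * duhamel l c t + c t) t := by
  have h1 : HasDerivAt (fun t => ∫ s in (0 : ℝ)..t, Real.exp (l * s) * c s)
      (Real.exp (l * t) * c t) t :=
    intervalIntegral.integral_hasDerivAt_right (Continuous.intervalIntegrable (by fun_prop) _ _)
      (Continuous.stronglyMeasurableAtFilter (by fun_prop) _ _)
      (Continuous.continuousAt (by fun_prop))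
  have h2 : HasDerivAt (fun t => Real.exp (-l * t)) (Real.exp (-l * t) * -l) t := by
    have : HasDerivAt (fun t => -l * t) (-l) t := by simpa using (hasDerivAt_id t).const_mul (-l)
    exact this.exp
  refine (h2.mul h1).congr_deriv ?_
  have h3 : Real.exp (-l * t) * Real.exp (l * t) = 1 := by
    rw [← Real.exp_add]; simp
  unfold duhamel
  linear_combination c t * h3

theorem continuous_duhamel {l : ℝ} {c : ℝ → ℝ} (hc : Continuous c) : Continuous (duhamel l c) :=
  continuous_iff_continuousAt.2 fun t => (hasDerivAt_duhamel hc t).continuousAt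

theorem duhamel_zero (l : ℝ) (c : ℝ → ℝ) : duhamel l c 0 = 0 := by simp [duhamel]

/-- Young's inequality with weight q replaces Cauchy–Schwarz, so that the bounds of the modes can
simply be added. -/
theorem abs_duhamel_le {l κ q S t : ℝ} {c : ℝ → ℝ} (hc : Continuous c) (hq : 0 < q)
    (ht : t ∈ Icc 0 S)
    (hκ : ∫ s in (0 : ℝ)..t, Real.exp (-l * (t - s)) ^ 2 ≤ κ) :
    |duhamel l c t| ≤ q / 2 * κ + (2 * q)⁻¹ * ∫ s in (0 : ℝ)..S, c s ^ 2 := by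
  have h1 : duhamel l c t = ∫ s in (0 : ℝ)..t, Real.exp (-l * (t - s)) * c s := by
    unfold duhamel
    rw [← intervalIntegral.integral_const_mul]
    refine intervalIntegral.integral_congr fun s _ => ?_
    rw [← mul_assoc, ← Real.exp_add]
    congr 2
    ring
  have h2 : ∫ s in (0 : ℝ)..t, c s ^ 2 ≤ ∫ s in (0 : ℝ)..S, c s ^ 2 :=
    intervalIntegral.integral_mono_interval le_rfl ht.1 ht.2
      (Filter.Eventually.of_forall fun s => sq_nonneg _)
      (Continuous.intervalIntegrable (by fun_prop) _ _)
  calc |duhamel l c t| ≤ ∫ s in (0 : ℝ)..t, |Real.exp (-l * (t - s)) * c s| := by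
        rw [h1]; exact intervalIntegral.abs_integral_le_integral_abs ht.1
    _ ≤ ∫ s in (0 : ℝ)..t, (q / 2 * Real.exp (-l * (t - s)) ^ 2 + (2 * q)⁻¹ * c s ^ 2) := by
        refine intervalIntegral.integral_mono_on ht.1
          (Continuous.intervalIntegrable (by fun_prop) _ _)
          (Continuous.intervalIntegrable (by fun_prop) _ _) fun s _ => ?_
        set a := Real.exp (-l * (t - s))
        rw [abs_mul, ← sq_abs a, ← sq_abs (c s)]
        have : q / 2 * |a| ^ 2 + (2 * q)⁻¹ * |c s| ^ 2 - |a| * |c s| =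
            (2 * q)⁻¹ * (q * |a| - |c s|) ^ 2 := by field_simp; ring
        have h3 : 0 ≤ (2 * q)⁻¹ * (q * |a| - |c s|) ^ 2 := by positivity
        linarith
    _ = q / 2 * (∫ s in (0 : ℝ)..t, Real.exp (-l * (t - s)) ^ 2) +
          (2 * q)⁻¹ * ∫ s in (0 : ℝ)..t, c s ^ 2 := by
        rw [intervalIntegral.integral_add (Continuous.intervalIntegrable (by fun_prop) _ _)
          (Continuous.intervalIntegrable (by fun_prop) _ _), intervalIntegral.integral_const_mul,
          intervalIntegral.integral_const_mul]
    _ ≤ _ := by gcongr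

/-- For n ≥ 1 the integral is at most 1/(2(nπ)²). For n = 0 it equals t, and the last term is 1/0 =
0. -/
theorem integral_exp_sq_le (n : ℕ) {S t : ℝ} (ht : t ∈ Icc 0 S) :
    ∫ s in (0 : ℝ)..t, Real.exp (-(n * Real.pi) ^ 2 * (t - s)) ^ 2 ≤
      (if n = 0 then S else 0) + 1 / (n : ℝ) ^ 2 := by
  rcases eq_or_ne n 0 with rfl | hn
  · simp [ht.2]
  · set l : ℝ := (n * Real.pi) ^ 2 with hl
    have hn0 : (0 : ℝ) < n := by exact_mod_cast Nat.pos_of_ne_zero hn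
    have hl0 : 0 < l := by positivity
    have hln : (n : ℝ) ^ 2 ≤ 2 * l := by
      rw [hl, mul_pow]
      have h9 : (1 : ℝ) ≤ Real.pi ^ 2 := by nlinarith [Real.pi_gt_three]
      nlinarith [mul_le_mul_of_nonneg_left h9 (sq_nonneg (n : ℝ)), sq_nonneg (n : ℝ)]
    have hF : ∀ s ∈ uIcc 0 t, HasDerivAt (fun s => Real.exp (-(2 * l) * (t - s)) / (2 * l))
        (Real.exp (-l * (t - s)) ^ 2) s := by
      intro s _
      have h1 : HasDerivAt (fun s => -(2 * l) * (t - s)) (2 * l) s := by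
        simpa using ((hasDerivAt_id s).const_sub t).const_mul (-(2 * l))
      refine (h1.exp.div_const (2 * l)).congr_deriv ?_
      rw [mul_div_assoc, div_self (by positivity), mul_one, ← Real.exp_nat_mul]
      congr 1
      push_cast
      ring
    rw [intervalIntegral.integral_eq_sub_of_hasDerivAt hF
      (Continuous.intervalIntegrable (by fun_prop) _ _)]
    have h2 : 0 ≤ Real.exp (-(2 * l) * (t - 0)) / (2 * l) := by positivity
    have h3 : 1 / (2 * l) ≤ 1 / (n : ℝ) ^ 2 := one_div_le_one_div_of_le (by positivity) hln
    simp only [sub_self, mul_zero, Real.exp_zero, if_neg hn, zero_add]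
    linarith

/-- The constant in the estimate of solutions of the heat equation with square integrable forcing. -/
noncomputable def heatBound (S : ℝ) : ℝ := S + (∑' n : ℕ, 1 / (n : ℝ) ^ 2) + 1

theorem heatBound_pos {S : ℝ} (hS : 0 ≤ S) : 0 < heatBound S := by
  have : 0 ≤ ∑' n : ℕ, 1 / (n : ℝ) ^ 2 := tsum_nonneg fun n => by positivity
  unfold heatBound
  linarith

/-- The forcing coefficients are square summable by orthogonality and the squared L² norms of the
heat exponentials are summable over n, which is where dimension one enters. -/
theorem abs_cosSum_duhamel_le {S q : ℝ} (hq : 0 < q) {N : ℕ} {c : ℕ → ℝ → ℝ}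
    (hc : ∀ n, Continuous (c n)) (hcq : ∫ p in rect S, cosSum N c p ^ 2 ≤ q ^ 2)
    {p : ℝ × ℝ} (hp : p ∈ rect S) :
    |cosSum N (fun n => duhamel ((n * Real.pi) ^ 2) (c n)) p| ≤ heatBound S * q := by
  have hS : 0 ≤ S := hp.2.1.trans hp.2.2
  have hcont := continuous_cosSum (N := N) hc
  have hpars : ∑ n ∈ Finset.range N, ∫ s in (0 : ℝ)..S, c n s ^ 2 ≤ 2 * q ^ 2 := by
    have hsq : IntegrableOn (fun p => cosSum N c p ^ 2) (rect S) :=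
      (hcont.pow 2).continuousOn.integrableOn_compact (isCompact_rect S)
    have hci : ∀ n ∈ Finset.range N, IntervalIntegrable (fun s => c n s ^ 2) volume 0 S :=
      fun n _ => ((hc n).pow 2).intervalIntegrable _ _
    rw [← intervalIntegral.integral_finsetSum hci]
    calc _ ≤ ∫ s in (0 : ℝ)..S, 2 * ∫ x in (0 : ℝ)..1, cosSum N c (x, s) ^ 2 := by
          refine intervalIntegral.integral_mono_on hS ?_ ?_ fun s _ => ?_
          · exact Continuous.intervalIntegrable
              (continuous_finsetSum _ fun n _ => (hc n).pow 2) _ _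
          · exact (intervalIntegrable_integral_rect hS hsq).const_mul 2
          · exact sum_sq_le_integral_sq N fun n => c n s
      _ ≤ 2 * q ^ 2 := by
          rw [intervalIntegral.integral_const_mul, ← integral_rect_eq hS hsq]
          linarith
  have hsum : ∑ n ∈ Finset.range N, ((if n = 0 then S else 0) + 1 / (n : ℝ) ^ 2) ≤
      S + ∑' n : ℕ, 1 / (n : ℝ) ^ 2 := by
    rw [Finset.sum_add_distrib]
    refine add_le_add ?_ ((Real.summable_one_div_nat_pow.2 (by norm_num)).sum_le_tsum _
      fun n _ => by positivity)
    rw [Finset.sum_ite_eq']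
    split_ifs
    exacts [le_rfl, hS]
  calc |cosSum N (fun n => duhamel ((n * Real.pi) ^ 2) (c n)) p|
      ≤ ∑ n ∈ Finset.range N, |duhamel ((n * Real.pi) ^ 2) (c n) p.2| := by
        refine (Finset.abs_sum_le_sum_abs _ _).trans (Finset.sum_le_sum fun n _ => ?_)
        rw [abs_mul]
        exact mul_le_of_le_one_right (abs_nonneg _) (Real.abs_cos_le_one _)
    _ ≤ ∑ n ∈ Finset.range N, (q / 2 * ((if n = 0 then S else 0) + 1 / (n : ℝ) ^ 2) +
          (2 * q)⁻¹ * ∫ s in (0 : ℝ)..S, c n s ^ 2) :=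
        Finset.sum_le_sum fun n _ => abs_duhamel_le (hc n) hq hp.2 (integral_exp_sq_le n hp.2)
    _ ≤ q / 2 * (S + ∑' n : ℕ, 1 / (n : ℝ) ^ 2) + (2 * q)⁻¹ * (2 * q ^ 2) := by
        rw [Finset.sum_add_distrib, ← Finset.mul_sum, ← Finset.mul_sum]
        gcongr
    _ ≤ heatBound S * q := by
        have h1 : (2 * q)⁻¹ * (2 * q ^ 2) = q := by field_simp
        have h2 : 0 ≤ ∑' n : ℕ, 1 / (n : ℝ) ^ 2 := tsum_nonneg fun n => by positivity
        rw [h1, heatBound]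
        nlinarith

/-- Each mode solves its own linear ODE; the weak form is the fundamental theorem of calculus for
the pairing with φ. -/
theorem isWeakSolution_cosSum_duhamel {S : ℝ} {N : ℕ} {c : ℕ → ℝ → ℝ}
    (hc : ∀ n, Continuous (c n)) :
    IsWeakSolution S (fun x t => cosSum N (fun n => duhamel ((n * Real.pi) ^ 2) (c n)) (x, t))
      (cosSum N c) 0 0 := by
  intro t ht φ hφ h0 h1
  set v : ℕ → ℝ → ℝ := fun n => duhamel ((n * Real.pi) ^ 2) (c n) with hv
  have hvc : ∀ n, Continuous (v n) := fun n => continuous_duhamel (hc n)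
  have hφ2 := (contDiff_deriv_infty (contDiff_deriv_infty hφ)).continuous
  have hφ0 := hφ.continuous
  have hspace : ∀ (d : ℕ → ℝ → ℝ) (θ : ℝ → ℝ) (s : ℝ), Continuous θ →
      ∫ x in (0 : ℝ)..1, cosSum N d (x, s) * θ x =
        ∑ n ∈ Finset.range N, d n s * ∫ x in (0 : ℝ)..1, Real.cos (n * Real.pi * x) * θ x := by
    intro d θ s hθ
    simp only [cosSum, Finset.sum_mul, mul_assoc]
    rw [intervalIntegral.integral_finsetSum fun n _ =>
      Continuous.intervalIntegrable (by fun_prop) _ _]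
    exact Finset.sum_congr rfl fun n _ => intervalIntegral.integral_const_mul _ _
  have hrect : ∀ (d : ℕ → ℝ → ℝ) (θ : ℝ → ℝ), (∀ n, Continuous (d n)) → Continuous θ →
      ∫ p in rect t, cosSum N d (p.1, p.2) * θ p.1 =
        ∫ s in (0 : ℝ)..t, ∑ n ∈ Finset.range N, d n s *
          ∫ x in (0 : ℝ)..1, Real.cos (n * Real.pi * x) * θ x := by
    intro d θ hd hθ
    rw [integral_rect_eq ht.1]
    · exact intervalIntegral.integral_congr fun s _ => hspace d θ s hθ
    · exact (((continuous_cosSum hd).comp (by fun_prop)).mul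
        (hθ.comp continuous_fst)).continuousOn.integrableOn_compact (isCompact_rect t)
  have hderiv : ∀ s ∈ uIcc 0 t, HasDerivAt (fun s => ∑ n ∈ Finset.range N, v n s *
      ∫ x in (0 : ℝ)..1, Real.cos (n * Real.pi * x) * φ x)
      ((∑ n ∈ Finset.range N, v n s *
        ∫ x in (0 : ℝ)..1, Real.cos (n * Real.pi * x) * deriv (deriv φ) x) +
       ∑ n ∈ Finset.range N, c n s *
        ∫ x in (0 : ℝ)..1, Real.cos (n * Real.pi * x) * φ x) s := by
    intro s _
    refine (HasDerivAt.fun_sum fun n _ =>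
      (hasDerivAt_duhamel (hc n) s).mul_const _).congr_deriv ?_
    rw [← Finset.sum_add_distrib]
    refine Finset.sum_congr rfl fun n _ => ?_
    rw [integral_cos_mul_deriv_deriv n hφ h0 h1]
    simp only [hv]
    ring
  have hci : ∀ (d : ℕ → ℝ → ℝ) (m : ℕ → ℝ), (∀ n, Continuous (d n)) →
      IntervalIntegrable (fun s => ∑ n ∈ Finset.range N, d n s * m n) volume 0 t :=
    fun d m hd => Continuous.intervalIntegrable
      (continuous_finsetSum _ fun n _ => (hd n).mul continuous_const) _ _
  have hftc := intervalIntegral.integral_eq_sub_of_hasDerivAt hderiv ((hci _ _ hvc).add (hci _ _ hc))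
  rw [intervalIntegral.integral_add (hci _ _ hvc) (hci _ _ hc), ← hrect v _ hvc hφ2,
    ← hrect c _ hc hφ0, ← hspace v φ t hφ0, ← hspace v φ 0 hφ0] at hftc
  simp only [Measure.restrict_zero, integral_zero_measure, add_zero, sub_zero, Prod.mk.eta] at hftc ⊢
  linarith

/-! ### Density of cosine sums, by Stone–Weierstrass. -/

/-- The functions `c(t) cos(nπx)` on a rectangle. -/
def cosModes (S : ℝ) : Set C(rect S, ℝ) :=
  {g | ∃ (n : ℕ) (c : ℝ → ℝ), Continuous c ∧
    ∀ p : rect S, g p = c p.1.2 * Real.cos (n * Real.pi * p.1.1)}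

/-- The product-to-sum formula for cosines, applied to generators. -/
theorem mul_mem_span_cosModes {S : ℝ} {g k : C(rect S, ℝ)}
    (hg : g ∈ Submodule.span ℝ (cosModes S)) (hk : k ∈ Submodule.span ℝ (cosModes S)) :
    g * k ∈ Submodule.span ℝ (cosModes S) := by
  have hmul : g * k ∈ Submodule.span ℝ (cosModes S) * Submodule.span ℝ (cosModes S) :=
    Submodule.mul_mem_mul hg hk
  rw [Submodule.span_mul_span] at hmul
  refine Submodule.span_le.2 ?_ hmul
  rintro _ ⟨g, ⟨n, c, hc, hg⟩, k, ⟨m, d, hd, hk⟩, rfl⟩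
  have key : ∀ n m : ℕ, m ≤ n → ∀ c d : ℝ → ℝ, Continuous c → Continuous d →
      ∀ f : C(rect S, ℝ), (∀ p : rect S, f p = c p.1.2 * Real.cos (n * Real.pi * p.1.1) *
        (d p.1.2 * Real.cos (m * Real.pi * p.1.1))) → f ∈ Submodule.span ℝ (cosModes S) := by
    intro n m hmn c d hc hd f hf
    let mode : ℕ → C(rect S, ℝ) := fun j =>
      ⟨fun p => (c p.1.2 * d p.1.2 / 2) * Real.cos (j * Real.pi * p.1.1), by fun_prop⟩
    have hmode : ∀ j, mode j ∈ Submodule.span ℝ (cosModes S) := fun j =>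
      Submodule.subset_span ⟨j, fun t => c t * d t / 2, by fun_prop, fun p => rfl⟩
    have : f = mode (n - m) + mode (n + m) := by
      ext p
      rw [hf p]
      simp only [mode, ContinuousMap.add_apply, ContinuousMap.coe_mk]
      rw [Nat.cast_sub hmn, Nat.cast_add,
        show ((n : ℝ) - m) * Real.pi * p.1.1 = n * Real.pi * p.1.1 - m * Real.pi * p.1.1 by ring,
        show ((n : ℝ) + m) * Real.pi * p.1.1 = n * Real.pi * p.1.1 + m * Real.pi * p.1.1 by ring,
        Real.cos_sub, Real.cos_add]
      ring
    rw [this]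
    exact Submodule.add_mem _ (hmode _) (hmode _)
  rcases le_total m n with h | h
  · exact key n m h c d hc hd _ fun p => by simp [hg, hk]
  · exact key m n h d c hd hc _ fun p => by simp [hg, hk, mul_comm]

/-- The algebra generated by the functions `c(t) cos(nπx)`. -/
def cosAlgebra (S : ℝ) : Subalgebra ℝ C(rect S, ℝ) :=
  (Submodule.span ℝ (cosModes S)).toSubalgebra
    (Submodule.subset_span ⟨0, fun _ => 1, continuous_const, fun p => by simp⟩)
    fun _ _ hg hk => mul_mem_span_cosModes hg hk

/-- The function t separates different times, and cos(πx) is injective on [0,1]. -/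
theorem separatesPoints_cosAlgebra (S : ℝ) : (cosAlgebra S).SeparatesPoints := by
  rintro ⟨⟨x, t⟩, hx, ht⟩ ⟨⟨y, s⟩, hy, hs⟩ hne
  by_cases hts : t = s
  · have hxy : x ≠ y := fun h => hne (by simp [h, hts])
    let g : C(rect S, ℝ) := ⟨fun p => Real.cos (Real.pi * p.1.1), by fun_prop⟩
    refine ⟨g, ⟨g, Submodule.subset_span ⟨1, fun _ => 1, continuous_const, fun p => by simp [g]⟩,
      rfl⟩, fun h => hxy ?_⟩
    have hmem : ∀ z ∈ Icc (0 : ℝ) 1, Real.pi * z ∈ Icc 0 Real.pi := fun z hz =>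
      ⟨mul_nonneg Real.pi_pos.le hz.1, mul_le_of_le_one_right Real.pi_pos.le hz.2⟩
    exact mul_left_cancel₀ Real.pi_ne_zero (Real.injOn_cos (hmem x hx) (hmem y hy) h)
  · let g : C(rect S, ℝ) := ⟨fun p => p.1.2, by fun_prop⟩
    exact ⟨g, ⟨g, Submodule.subset_span ⟨0, fun t => t, continuous_id, fun p => by simp [g]⟩,
      rfl⟩, hts⟩

theorem exists_cosSum_eq {S : ℝ} {g : C(rect S, ℝ)} (hg : g ∈ Submodule.span ℝ (cosModes S)) :
    ∃ (N : ℕ) (c : ℕ → ℝ → ℝ), (∀ n, Continuous (c n)) ∧ ∀ p : rect S, g p = cosSum N c p.1 := by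
  -- Asking for every length M ≥ N lets two sums be brought to a common length and added.
  suffices h : ∃ (N : ℕ) (c : ℕ → ℝ → ℝ), (∀ n, Continuous (c n)) ∧
      ∀ M ≥ N, ∀ p : rect S, g p = cosSum M c p.1 by
    obtain ⟨N, c, hc, h⟩ := h
    exact ⟨N, c, hc, h N le_rfl⟩
  induction hg using Submodule.span_induction with
  | mem g hg =>
    obtain ⟨n, c, hc, hg⟩ := hg
    refine ⟨n + 1, fun m => if m = n then c else 0, fun m => ?_, fun M hM p => ?_⟩
    · change Continuous (if m = n then c else 0)
      split_ifs
      exacts [hc, continuous_const]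
    · rw [hg p, cosSum, Finset.sum_eq_single n]
      · simp
      · intro m _ hm; simp [hm]
      · intro h; exact absurd (Finset.mem_range.2 (by omega)) h
  | zero => exact ⟨0, fun _ _ => 0, fun _ => continuous_const, fun M _ p => by simp [cosSum]⟩
  | add g k _ _ hg hk =>
    obtain ⟨N, c, hc, hg⟩ := hg
    obtain ⟨M, d, hd, hk⟩ := hk
    refine ⟨max N M, fun n t => c n t + d n t, fun n => (hc n).add (hd n), fun m hm p => ?_⟩
    rw [ContinuousMap.add_apply, hg m (le_of_max_le_left hm), hk m (le_of_max_le_right hm)]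
    simp [cosSum, add_mul, Finset.sum_add_distrib]
  | smul a g _ hg =>
    obtain ⟨N, c, hc, hg⟩ := hg
    refine ⟨N, fun n t => a * c n t, fun n => (hc n).const_mul a, fun m hm p => ?_⟩
    rw [ContinuousMap.smul_apply, hg m hm]
    simp [cosSum, Finset.mul_sum, mul_assoc]

theorem exists_cosSum_near {S ε : ℝ} {g : ℝ × ℝ → ℝ} (hg : Continuous g) (hε : 0 < ε) :
    ∃ (N : ℕ) (c : ℕ → ℝ → ℝ), (∀ n, Continuous (c n)) ∧
      ∀ p ∈ rect S, |g p - cosSum N c p| ≤ ε := by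
  have : CompactSpace (rect S) := isCompact_iff_compactSpace.1 (isCompact_rect S)
  obtain ⟨⟨k, hk⟩, hnear⟩ := ContinuousMap.exists_mem_subalgebra_near_continuous_of_separatesPoints
    (cosAlgebra S) (separatesPoints_cosAlgebra S) (fun p : rect S => g p)
    (hg.comp continuous_subtype_val) ε hε
  obtain ⟨N, c, hc, hkc⟩ := exists_cosSum_eq (g := k) hk
  refine ⟨N, c, hc, fun p hp => ?_⟩
  have := hnear ⟨p, hp⟩
  rw [← hkc ⟨p, hp⟩, abs_sub_comm]
  exact this.le

/-- Cosine sums with continuous coefficients are dense in `L²`. -/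
theorem exists_cosSum_integral_sq_sub_le {S ε : ℝ} {a : ℝ × ℝ → ℝ}
    (ha : MemLp a 2 (volume.restrict (rect S))) (hε : 0 < ε) :
    ∃ (N : ℕ) (c : ℕ → ℝ → ℝ), (∀ n, Continuous (c n)) ∧
      ∫ p in rect S, (a p - cosSum N c p) ^ 2 ≤ ε := by
  have := isFiniteMeasure_volume_restrict_rect S
  set m : ℝ := (volume.restrict (rect S) : Measure (ℝ × ℝ)).real univ with hm
  have hm0 : 0 ≤ m := measureReal_nonneg
  obtain ⟨g, hga, hg⟩ := ha.exists_boundedContinuous_eLpNorm_sub_le (by norm_num)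
    (ε := ENNReal.ofReal (Real.sqrt (ε / 4))) (by simpa using hε)
  have hsq : ∫ p in rect S, (a p - g p) ^ 2 ≤ ε / 4 := by
    have hmem : MemLp (a - ⇑g) 2 (volume.restrict (rect S)) := ha.sub hg
    have h1 := hmem.eLpNorm_eq_integral_rpow_norm (by norm_num) (by norm_num)
    rw [h1] at hga
    have h2 := (ENNReal.ofReal_le_ofReal_iff (Real.sqrt_nonneg _)).1 hga
    have h3 : ∫ p in rect S, ‖(a - ⇑g) p‖ ^ (2 : ENNReal).toReal =
        ∫ p in rect S, (a p - g p) ^ 2 := by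
      refine integral_congr_ae (Filter.Eventually.of_forall fun p => ?_)
      simp
    rw [h3] at h2
    have h4 : (∫ p in rect S, (a p - g p) ^ 2) ^ ((2 : ENNReal).toReal)⁻¹ =
        Real.sqrt (∫ p in rect S, (a p - g p) ^ 2) := by
      rw [Real.sqrt_eq_rpow]; norm_num
    rw [h4] at h2
    exact (Real.sqrt_le_sqrt_iff (by positivity)).1 h2
  obtain ⟨N, c, hc, hgc⟩ := exists_cosSum_near (S := S) g.continuous
    (ε := Real.sqrt (ε / (4 * (m + 1)))) (by positivity)
  refine ⟨N, c, hc, ?_⟩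
  have hint1 : IntegrableOn (fun p => (a p - g p) ^ 2) (rect S) := (ha.sub hg).integrable_sq
  have hcg : Continuous fun p => g p - cosSum N c p := g.continuous.sub (continuous_cosSum hc)
  calc ∫ p in rect S, (a p - cosSum N c p) ^ 2
      ≤ ∫ p in rect S, (2 * (a p - g p) ^ 2 + 2 * (ε / (4 * (m + 1)))) := by
        refine integral_mono_of_nonneg (Filter.Eventually.of_forall fun p => sq_nonneg _)
          ((hint1.const_mul 2).add (integrable_const _)) ?_
        refine (ae_restrict_iff' (measurableSet_rect S)).2 (Filter.Eventually.of_forall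
          fun p hp => ?_)
        have h1 : (g p - cosSum N c p) ^ 2 ≤ ε / (4 * (m + 1)) := by
          rw [← Real.sq_sqrt (by positivity : 0 ≤ ε / (4 * (m + 1)))]
          exact sq_le_sq' (abs_le.1 (hgc p hp)).1 (abs_le.1 (hgc p hp)).2
        simp only
        nlinarith [sq_nonneg ((a p - g p) - (g p - cosSum N c p))]
    _ = 2 * (∫ p in rect S, (a p - g p) ^ 2) + m * (2 * (ε / (4 * (m + 1)))) := by
        rw [integral_add (hint1.const_mul 2) (integrable_const _), integral_const_mul,
          integral_const, smul_eq_mul]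
    _ ≤ ε := by
        have : m * (2 * (ε / (4 * (m + 1)))) ≤ ε / 2 := by
          rw [show m * (2 * (ε / (4 * (m + 1)))) = (ε / 2) * (m / (m + 1)) by field_simp; ring]
          exact mul_le_of_le_one_right (by positivity) ((div_le_one (by positivity)).2 (by linarith))
        linarith

/-! ### The a priori bound. -/

theorem IsWeakSolution.mono {S t : ℝ} {w : ℝ → ℝ → ℝ} {a : ℝ × ℝ → ℝ} {μ ν : Measure (ℝ × ℝ)}
    (h : IsWeakSolution S w a μ ν) (ht : t ≤ S) : IsWeakSolution t w a μ ν :=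
  fun s hs => h s ⟨hs.1, hs.2.trans ht⟩

theorem IsWeakSolution.sub {S : ℝ} {w w' : ℝ → ℝ → ℝ} {a a' : ℝ × ℝ → ℝ}
    {μ ν μ' ν' : Measure (ℝ × ℝ)} [IsFiniteMeasure μ] [IsFiniteMeasure ν] [IsFiniteMeasure μ']
    [IsFiniteMeasure ν'] (h : IsWeakSolution S w a μ ν) (h' : IsWeakSolution S w' a' μ' ν')
    (hw : ContinuousOn (Function.uncurry w) (rect S))
    (hw' : ContinuousOn (Function.uncurry w') (rect S))
    (ha : IntegrableOn a (rect S)) (ha' : IntegrableOn a' (rect S)) :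
    IsWeakSolution S (fun x t => w x t - w' x t) (fun p => a p - a' p) (μ + ν') (ν + μ') := by
  intro t ht φ hφ h0 h1
  have hφ2 := (contDiff_deriv_infty (contDiff_deriv_infty hφ)).continuous
  have hφ0 := hφ.continuous
  have hslice : ∀ {r : ℝ → ℝ → ℝ}, ContinuousOn (Function.uncurry r) (rect S) →
      ∀ s ∈ Icc 0 S, IntervalIntegrable (fun x => r x s * φ x) volume 0 1 := fun hr s hs => by
    refine ContinuousOn.intervalIntegrable ?_
    rw [uIcc_of_le zero_le_one]
    exact (continuousOn_slice hr hs).mul hφ0.continuousOn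
  have hw2 : ∀ {r : ℝ → ℝ → ℝ}, ContinuousOn (Function.uncurry r) (rect S) →
      IntegrableOn (fun p : ℝ × ℝ => r p.1 p.2 * deriv (deriv φ) p.1) (rect t) := fun hr =>
    (((hr.mul (hφ2.comp continuous_fst).continuousOn).mono
      (rect_subset_rect ht.2)).integrableOn_compact (isCompact_rect t))
  have hab : ∀ {b : ℝ × ℝ → ℝ}, IntegrableOn b (rect S) →
      IntegrableOn (fun p : ℝ × ℝ => b p * φ p.1) (rect t) := fun hb =>
    (hb.mono_set (rect_subset_rect ht.2)).mul_continuousOn (hφ0.comp continuous_fst).continuousOn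
      (isCompact_rect t)
  have hm : ∀ (θ : Measure (ℝ × ℝ)) [IsFiniteMeasure θ],
      Integrable (fun p : ℝ × ℝ => φ p.1) (θ.restrict (rect t)) := fun θ _ =>
    (hφ0.comp continuous_fst).continuousOn.integrableOn_compact (isCompact_rect t)
  have hS : (0 : ℝ) ∈ Icc 0 S := ⟨le_rfl, ht.1.trans ht.2⟩
  simp only [sub_mul, Measure.restrict_add]
  rw [intervalIntegral.integral_sub (hslice hw t ht) (hslice hw' t ht),
    intervalIntegral.integral_sub (hslice hw 0 hS) (hslice hw' 0 hS),
    integral_sub (hw2 hw) (hw2 hw'), integral_sub (hab ha) (hab ha'),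
    integral_add_measure (hm μ) (hm ν'), integral_add_measure (hm ν) (hm μ'),
    h t ht φ hφ h0 h1, h' t ht φ hφ h0 h1]
  ring

/-- The integral of φ'' is φ'(1) - φ'(0) = 0. Constants are needed to lift the barrier above zero.
-/
theorem isWeakSolution_const (S c : ℝ) : IsWeakSolution S (fun _ _ => c) (fun _ => 0) 0 0 := by
  intro t ht φ hφ h0 h1
  have hφ1 := contDiff_deriv_infty hφ
  have hφ2 := (contDiff_deriv_infty hφ1).continuous
  have hz : ∫ x in (0 : ℝ)..1, deriv (deriv φ) x = 0 := by
    rw [intervalIntegral.integral_eq_sub_of_hasDerivAt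
      (fun x _ => (hφ1.differentiable (by simp) x).hasDerivAt) (hφ2.intervalIntegrable _ _), h0, h1,
      sub_zero]
  have hr : ∫ p in rect t, c * deriv (deriv φ) p.1 = 0 := by
    rw [integral_rect_eq (g := fun p => c * deriv (deriv φ) p.1) ht.1
      ((continuous_const.mul (hφ2.comp continuous_fst)).continuousOn.integrableOn_compact
        (isCompact_rect t))]
    simp [hz]
  rw [hr]
  simp

/-- The a priori bound for weak solutions that are pushed upwards only where they are
nonpositive. -/
theorem IsWeakSolution.le_add_heatBound_mul {S : ℝ} (hS : 0 ≤ S) {w : ℝ → ℝ → ℝ} {a : ℝ × ℝ → ℝ}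
    {μ ν : Measure (ℝ × ℝ)} [IsFiniteMeasure μ] [IsFiniteMeasure ν]
    (hsol : IsWeakSolution S w a μ ν) (hw : ContinuousOn (Function.uncurry w) (rect S))
    (ha : MemLp a 2 (volume.restrict (rect S))) (hμ : μ {p ∈ rect S | 0 < w p.1 p.2} = 0)
    {m q : ℝ} (hm : 0 ≤ m) (hwm : ∀ x ∈ Icc (0 : ℝ) 1, w x 0 ≤ m) (hq : 0 < q)
    (haq : ∫ p in rect S, a p ^ 2 ≤ q ^ 2) {p : ℝ × ℝ} (hp : p ∈ rect S) :
    w p.1 p.2 ≤ m + 4 * heatBound S * q := by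
  have := isFiniteMeasure_volume_restrict_rect S
  set v : ℝ := (volume.restrict (rect S) : Measure (ℝ × ℝ)).real univ with hv
  have hv0 : 0 ≤ v := measureReal_nonneg
  refine le_of_forall_pos_le_add fun ε hε => ?_
  obtain ⟨M, hM0, hM⟩ := exists_upper_bound_of_isWeakSolution hS hw hμ (ν := ν) (half_pos hε)
  -- The bound q keeps the cosine sum within L² norm 2q; the other one makes M times the L¹
  -- remainder at most ε/2.
  set δ : ℝ := min q (ε / (2 * (M + 1) * (v + 1))) with hδ
  have hδ0 : 0 < δ := lt_min hq (by positivity)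
  obtain ⟨N, c, hc, hac⟩ := exists_cosSum_integral_sq_sub_le ha (pow_pos hδ0 2)
  have hcc := continuous_cosSum (N := N) hc
  have hcL : MemLp (cosSum N c) 2 (volume.restrict (rect S)) := by
    obtain ⟨B, hB⟩ := (isCompact_rect S).exists_bound_of_continuousOn hcc.continuousOn
    exact MemLp.of_bound hcc.aestronglyMeasurable B
      ((ae_restrict_iff' (measurableSet_rect S)).2 (Filter.Eventually.of_forall hB))
  have hbL : MemLp (fun p => a p - cosSum N c p) 2 (volume.restrict (rect S)) := ha.sub hcL
  have hcq : ∫ p in rect S, cosSum N c p ^ 2 ≤ (2 * q) ^ 2 := by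
    have h1 : ∫ p in rect S, cosSum N c p ^ 2 ≤
        ∫ p in rect S, (2 * a p ^ 2 + 2 * (a p - cosSum N c p) ^ 2) := by
      refine integral_mono hcL.integrable_sq
        ((ha.integrable_sq.const_mul 2).add (hbL.integrable_sq.const_mul 2)) fun p => ?_
      simp only
      nlinarith [sq_nonneg (2 * a p - cosSum N c p)]
    rw [integral_add (ha.integrable_sq.const_mul 2) (hbL.integrable_sq.const_mul 2),
      integral_const_mul, integral_const_mul] at h1
    have h2 : δ ^ 2 ≤ q ^ 2 := pow_le_pow_left₀ hδ0.le (min_le_left _ _) 2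
    nlinarith
  have hb1 : ∫ p in rect S, |a p - cosSum N c p| ≤ δ * (v + 1) := by
    calc ∫ p in rect S, |a p - cosSum N c p|
        ≤ ∫ p in rect S, (δ / 2 + (2 * δ)⁻¹ * (a p - cosSum N c p) ^ 2) := by
          refine integral_mono (hbL.integrable (by norm_num)).abs
            ((integrable_const _).add (hbL.integrable_sq.const_mul _)) fun p => ?_
          simp only
          rw [← sq_abs]
          set b := |a p - cosSum N c p|
          have h1 : δ / 2 + (2 * δ)⁻¹ * b ^ 2 - b = (2 * δ)⁻¹ * (δ - b) ^ 2 := by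
            field_simp; ring
          have h2 : 0 ≤ (2 * δ)⁻¹ * (δ - b) ^ 2 := by positivity
          linarith
      _ = v * (δ / 2) + (2 * δ)⁻¹ * ∫ p in rect S, (a p - cosSum N c p) ^ 2 := by
          rw [integral_add (integrable_const _) (hbL.integrable_sq.const_mul _),
            integral_const_mul, integral_const, smul_eq_mul]
      _ ≤ v * (δ / 2) + (2 * δ)⁻¹ * δ ^ 2 := by gcongr
      _ ≤ δ * (v + 1) := by
          have : (2 * δ)⁻¹ * δ ^ 2 = δ / 2 := by field_simp
          rw [this]
          nlinarith
  set B : ℝ := heatBound S * (2 * q) with hB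
  have hB0 : 0 ≤ B := mul_nonneg (heatBound_pos hS).le (by linarith)
  set U : ℝ → ℝ → ℝ :=
    fun x t => cosSum N (fun n => duhamel ((n * Real.pi) ^ 2) (c n)) (x, t) with hU
  have hUc : Continuous (Function.uncurry U) :=
    continuous_cosSum fun n => continuous_duhamel (hc n)
  have hUb : ∀ p ∈ rect S, |U p.1 p.2| ≤ B := fun p hp =>
    abs_cosSum_duhamel_le (by linarith) hc hcq hp
  have hU0 : ∀ x, U x 0 = 0 := fun x => by simp [hU, cosSum, duhamel_zero]
  have hsolU := (hsol.sub (isWeakSolution_cosSum_duhamel (N := N) hc) hw hUc.continuousOn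
    (ha.integrable (by norm_num)) (hcL.integrable (by norm_num))).sub
      (isWeakSolution_const S (m + B)) (hw.sub hUc.continuousOn) continuousOn_const
      (hbL.integrable (by norm_num)) (integrable_zero _ _ _)
  -- The barrier U + m + B lies between 0 and m + 2B and starts at m + B ≥ m; here 2B is the term 4
  -- · `heatBound S` · q of the claim.
  have hmain := hM (fun x t => U x t + (m + B)) (fun p => a p - cosSum N c p) (m + 2 * B)
    (hUc.add continuous_const).continuousOn
    (fun p hp => by
      have := abs_le.1 (hUb p hp)
      constructor <;> linarith)
    (fun x hx => by rw [hU0]; linarith [hwm x hx]) (hbL.integrable (by norm_num))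
    (by simpa [sub_sub, hU] using hsolU) p hp
  have hMδ : M * (δ * (v + 1)) ≤ ε / 2 := by
    have h1 : δ ≤ ε / (2 * (M + 1) * (v + 1)) := min_le_right _ _
    rw [le_div_iff₀ (by positivity)] at h1
    nlinarith [mul_nonneg hδ0.le (by linarith : 0 ≤ v + 1)]
  have := mul_le_mul_of_nonneg_left hb1 hM0
  rw [hB] at hmain
  linarith

/-! ### Gronwall's inequality by doubling. -/

/-- A Gronwall inequality with respect to a continuous time change `A`. -/
theorem le_two_pow_mul_of_sub_le {S B : ℝ} {A H : ℝ → ℝ} (hB : 0 < B)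
    (hA : ContinuousOn A (Icc 0 S)) (hA0 : A 0 = 0) (hH : ∀ t ∈ Icc 0 S, 0 ≤ H t)
    (hstep : ∀ s t, 0 ≤ s → s ≤ t → t ≤ S → H t - H s ≤ B * (A t - A s) * H t) (n : ℕ) :
    ∀ t ∈ Icc 0 S, 2 * B * A t ≤ n → H t ≤ 2 ^ n * H 0 := by
  induction n with
  | zero =>
    intro t ht hAt
    have h1 := hstep 0 t le_rfl ht.1 ht.2
    have h2 : B * (A t - A 0) * H t ≤ 0 :=
      mul_nonpos_of_nonpos_of_nonneg (by rw [hA0]; push_cast at hAt; linarith) (hH t ht)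
    simp only [pow_zero, one_mul]
    linarith
  | succ n ih =>
    intro t ht hAt
    have hH0 : 0 ≤ H 0 := hH 0 ⟨le_rfl, ht.1.trans ht.2⟩
    rcases le_or_gt (2 * B * A t) n with hle | hgt
    · refine (ih t ht hle).trans ?_
      rw [pow_succ]
      nlinarith [mul_nonneg (pow_pos (two_pos : (0 : ℝ) < 2) n).le hH0]
    -- Choose s ≤ t with A(s) = n/(2B). Then B(A(t) - A(s)) ≤ 1/2, and the step inequality gives
    -- H(t) ≤ 2H(s).
    · have hmem : (n : ℝ) / (2 * B) ∈ Icc (A 0) (A t) := by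
        rw [hA0]
        refine ⟨by positivity, ?_⟩
        rw [div_le_iff₀ (by positivity)]
        linarith
      obtain ⟨s, hs, hAs⟩ := intermediate_value_Icc ht.1
        (hA.mono (Icc_subset_Icc_right ht.2)) hmem
      have hAs' : 2 * B * A s = n := by rw [hAs]; field_simp
      have h1 := ih s ⟨hs.1, hs.2.trans ht.2⟩ hAs'.le
      have h2 := hstep s t hs.1 hs.2 ht.2
      have h3 : B * (A t - A s) * H t ≤ 1 / 2 * H t := by
        refine mul_le_mul_of_nonneg_right ?_ (hH t ht)
        push_cast at hAt
        linarith
      rw [pow_succ]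
      linarith

/-! ### Differences of solutions of the skeleton equation. -/

/-- The total forcing of the skeleton equation along `u`. -/
def drift (α : ℝ) (f σ h u : ℝ → ℝ → ℝ) (p : ℝ × ℝ) : ℝ :=
  -α * u p.1 p.2 + f p.1 (u p.1 p.2) + σ p.1 (u p.1 p.2) * h p.1 p.2

theorem aestronglyMeasurable_comp_graph {g u : ℝ → ℝ → ℝ} {S : ℝ}
    (hg : Measurable (Function.uncurry g)) (hu : ContinuousOn (Function.uncurry u) (rect S)) :
    AEStronglyMeasurable (fun p : ℝ × ℝ => g p.1 (u p.1 p.2)) (volume.restrict (rect S)) := by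
  have hum : AEMeasurable (Function.uncurry u) (volume.restrict (rect S)) :=
    hu.aemeasurable (measurableSet_rect S)
  exact (hg.comp_aemeasurable (measurable_fst.aemeasurable.prodMk hum)).aestronglyMeasurable

section Coefficients

variable {α S : ℝ} {f σ h u : ℝ → ℝ → ℝ}

theorem memLp_of_continuousOn (hu : ContinuousOn (Function.uncurry u) (rect S)) :
    MemLp (fun p : ℝ × ℝ => u p.1 p.2) 2 (volume.restrict (rect S)) := by
  have := isFiniteMeasure_volume_restrict_rect S
  obtain ⟨B, hB⟩ := (isCompact_rect S).exists_bound_of_continuousOn hu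
  exact MemLp.of_bound (hu.aestronglyMeasurable (measurableSet_rect S)) B
    ((ae_restrict_iff' (measurableSet_rect S)).2 (Filter.Eventually.of_forall hB))

theorem AdmissibleCoefficients.memLp_f (hF : AdmissibleCoefficients f σ)
    (hu : ContinuousOn (Function.uncurry u) (rect S)) :
    MemLp (fun p : ℝ × ℝ => f p.1 (u p.1 p.2)) 2 (volume.restrict (rect S)) := by
  have := isFiniteMeasure_volume_restrict_rect S
  obtain ⟨M, hM⟩ := hF.bounded
  exact MemLp.of_bound (aestronglyMeasurable_comp_graph hF.measurable_f hu) M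
    ((ae_restrict_iff' (measurableSet_rect S)).2
      (Filter.Eventually.of_forall fun p hp => (hM p.1 hp.1 _).1))

theorem AdmissibleCoefficients.memLp_σ_mul (hF : AdmissibleCoefficients f σ)
    (hu : ContinuousOn (Function.uncurry u) (rect S)) (hh : IsControl S h) :
    MemLp (fun p : ℝ × ℝ => σ p.1 (u p.1 p.2) * h p.1 p.2) 2 (volume.restrict (rect S)) := by
  obtain ⟨M, hM⟩ := hF.bounded
  refine MemLp.of_le_mul (c := M) hh
    ((aestronglyMeasurable_comp_graph hF.measurable_σ hu).mul hh.aestronglyMeasurable)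
    ((ae_restrict_iff' (measurableSet_rect S)).2 (Filter.Eventually.of_forall fun p hp => ?_))
  rw [norm_mul]
  exact mul_le_mul_of_nonneg_right (hM p.1 hp.1 _).2 (norm_nonneg _)

theorem AdmissibleCoefficients.memLp_drift (hF : AdmissibleCoefficients f σ)
    (hu : ContinuousOn (Function.uncurry u) (rect S)) (hh : IsControl S h) :
    MemLp (drift α f σ h u) 2 (volume.restrict (rect S)) :=
  (((memLp_of_continuousOn hu).const_mul (-α)).add (hF.memLp_f hu)).add (hF.memLp_σ_mul hu hh)

/-- The Lipschitz factor is unbounded because of h, but it is square integrable, which is all that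
the Gronwall argument needs. -/
theorem abs_drift_sub_le {L : ℝ} {v : ℝ → ℝ → ℝ} {p : ℝ × ℝ}
    (hL : ∀ x ∈ Icc (0 : ℝ) 1, ∀ y y' : ℝ, |f x y - f x y'| + |σ x y - σ x y'| ≤ L * |y - y'|)
    (hp : p ∈ rect S) :
    |drift α f σ h u p - drift α f σ h v p| ≤
      (|α| + L + L * |h p.1 p.2|) * |u p.1 p.2 - v p.1 p.2| := by
  obtain ⟨x, t⟩ := p
  have hl := hL x hp.1 (u x t) (v x t)
  have hf : |f x (u x t) - f x (v x t)| ≤ L * |u x t - v x t| := by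
    linarith [abs_nonneg (σ x (u x t) - σ x (v x t))]
  have hσ : |σ x (u x t) - σ x (v x t)| ≤ L * |u x t - v x t| := by
    linarith [abs_nonneg (f x (u x t) - f x (v x t))]
  have hsplit : drift α f σ h u (x, t) - drift α f σ h v (x, t) =
      -α * (u x t - v x t) + (f x (u x t) - f x (v x t)) +
        (σ x (u x t) - σ x (v x t)) * h x t := by
    simp only [drift]; ring
  rw [hsplit]
  refine (abs_add_three _ _ _).trans ?_
  rw [abs_mul, abs_mul, abs_neg]
  nlinarith [mul_le_mul_of_nonneg_right hσ (abs_nonneg (h x t))]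

end Coefficients

section Triplets

variable {K₁ K₂ u₀ : ℝ → ℝ} {α S : ℝ} {f σ h u : ℝ → ℝ → ℝ} {η ξ : Measure (ℝ × ℝ)}

/-- The measures are restricted because they are only known to be finite on the rectangle. -/
theorem IsSolutionTriplet.isWeakSolution
    (hu : IsSolutionTriplet K₁ K₂ α f σ h u₀ S u η ξ) (hF : AdmissibleCoefficients f σ)
    (hh : IsControl S h) :
    IsWeakSolution S u (drift α f σ h u) (η.restrict (rect S)) (ξ.restrict (rect S)) := by
  have := isFiniteMeasure_volume_restrict_rect S
  intro t ht φ hφ h0 h1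
  have hφ2 := (contDiff_deriv_infty (contDiff_deriv_infty hφ)).continuous
  have hφ0 := hφ.continuous
  have hsub := rect_subset_rect ht.2
  have hmul : ∀ {b : ℝ × ℝ → ℝ} {θ : ℝ → ℝ}, MemLp b 2 (volume.restrict (rect S)) →
      Continuous θ → IntegrableOn (fun p : ℝ × ℝ => b p * θ p.1) (rect t) := fun hb hθ =>
    ((show IntegrableOn _ _ _ from hb.integrable (by norm_num)).mono_set hsub).mul_continuousOn
      (hθ.comp continuous_fst).continuousOn (isCompact_rect t)
  have huL := memLp_of_continuousOn hu.continuousOn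
  have i1 := hmul huL hφ2
  have i2 := hmul (hF.memLp_f hu.continuousOn) hφ0
  have i3 := hmul (hF.memLp_σ_mul hu.continuousOn hh) hφ0
  have i4 := hmul huL hφ0
  have e3 : (∫ s in (0 : ℝ)..t, ∫ x in (0 : ℝ)..1, φ x * σ x (u x s) * h x s) =
      ∫ p in rect t, σ p.1 (u p.1 p.2) * h p.1 p.2 * φ p.1 := by
    rw [integral_rect_eq ht.1 i3]
    refine intervalIntegral.integral_congr fun s _ => ?_
    refine intervalIntegral.integral_congr fun x _ => ?_
    simp only
    ring
  have hinit : ∫ x in (0 : ℝ)..1, u x 0 * φ x = ∫ x in (0 : ℝ)..1, u₀ x * φ x := by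
    refine intervalIntegral.integral_congr fun x hx => ?_
    rw [uIcc_of_le zero_le_one] at hx
    simp only [hu.initial x hx]
  have hwf := hu.weak_form t ht φ hφ h0 h1
  rw [e3, ← integral_rect_eq ht.1 i1, ← integral_rect_eq ht.1 i2, ← integral_rect_eq ht.1 i4,
    ← hinit] at hwf
  have hdrift : ∫ p in rect t, drift α f σ h u p * φ p.1 =
      -α * (∫ p in rect t, u p.1 p.2 * φ p.1) + (∫ p in rect t, f p.1 (u p.1 p.2) * φ p.1) +
        ∫ p in rect t, σ p.1 (u p.1 p.2) * h p.1 p.2 * φ p.1 := by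
    have i5 : IntegrableOn (fun p => -α * (u p.1 p.2 * φ p.1) + f p.1 (u p.1 p.2) * φ p.1)
        (rect t) := (i4.const_mul _).add i2
    rw [← integral_const_mul, ← integral_add (i4.const_mul _) i2, ← integral_add i5 i3]
    refine integral_congr_ae (Filter.Eventually.of_forall fun p => ?_)
    simp only [drift]
    ring
  rw [hdrift, Measure.restrict_restrict (measurableSet_rect t),
    Measure.restrict_restrict (measurableSet_rect t), inter_eq_left.2 hsub]
  linarith

/-- Turns the complementarity integrals into the statement that each reflection measure lives on its
contact set. -/
theorem measure_pos_eq_zero_of_setIntegral_eq_zero {g : ℝ × ℝ → ℝ} {θ : Measure (ℝ × ℝ)}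
    (hθ : θ (rect S) < ⊤) (hg : ContinuousOn g (rect S)) (hg0 : ∀ p ∈ rect S, 0 ≤ g p)
    (hint : ∫ p in rect S, g p ∂θ = 0) : θ.restrict (rect S) {p ∈ rect S | 0 < g p} = 0 := by
  have : IsFiniteMeasure (θ.restrict (rect S)) := ⟨by simpa using hθ⟩
  have hi : IntegrableOn g (rect S) (θ.restrict (rect S)) :=
    hg.integrableOn_compact (isCompact_rect S)
  rw [IntegrableOn, Measure.restrict_restrict (measurableSet_rect S), inter_self] at hi
  have h0 : 0 ≤ᵐ[θ.restrict (rect S)] g :=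
    (ae_restrict_iff' (measurableSet_rect S)).2 (Filter.Eventually.of_forall hg0)
  have hz := (integral_eq_zero_iff_of_nonneg_ae h0 hi).1 hint
  refine measure_mono_null ?_ (ae_iff.1 hz)
  rintro p ⟨-, hp⟩
  exact hp.ne'

theorem IsSolutionTriplet.lower_null (hu : IsSolutionTriplet K₁ K₂ α f σ h u₀ S u η ξ)
    (hK : AdmissibleWalls K₁ K₂) :
    η.restrict (rect S) {p ∈ rect S | K₁ p.1 < u p.1 p.2} = 0 := by
  have := measure_pos_eq_zero_of_setIntegral_eq_zero hu.finite_lower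
    (hu.continuousOn.sub (hK.continuousOn_lower.comp continuousOn_fst fun p hp => hp.1))
    (fun p hp => sub_nonneg.2 (hu.between p.1 hp.1 p.2 hp.2).1) hu.complementarity_lower
  simpa [Function.uncurry] using this

theorem IsSolutionTriplet.upper_null (hu : IsSolutionTriplet K₁ K₂ α f σ h u₀ S u η ξ)
    (hK : AdmissibleWalls K₁ K₂) :
    ξ.restrict (rect S) {p ∈ rect S | u p.1 p.2 < K₂ p.1} = 0 := by
  have := measure_pos_eq_zero_of_setIntegral_eq_zero hu.finite_upper
    ((hK.continuousOn_upper.comp continuousOn_fst fun p hp => hp.1).sub hu.continuousOn)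
    (fun p hp => sub_nonneg.2 (hu.between p.1 hp.1 p.2 hp.2).2) hu.complementarity_upper
  simpa [Function.uncurry] using this

/-- The one-sided a priori bound for the difference of two solutions with the same control. -/
theorem IsSolutionTriplet.sub_le {v₀ : ℝ → ℝ} {v : ℝ → ℝ → ℝ} {η' ξ' : Measure (ℝ × ℝ)}
    (hu : IsSolutionTriplet K₁ K₂ α f σ h u₀ S u η ξ)
    (hv : IsSolutionTriplet K₁ K₂ α f σ h v₀ S v η' ξ')
    (hK : AdmissibleWalls K₁ K₂) (hF : AdmissibleCoefficients f σ) (hh : IsControl S h)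
    {m q t : ℝ} (hm : 0 ≤ m) (hinit : ∀ x ∈ Icc (0 : ℝ) 1, u₀ x - v₀ x ≤ m) (hq : 0 < q)
    (ht : t ∈ Icc 0 S)
    (hbq : ∫ p in rect t, (drift α f σ h u p - drift α f σ h v p) ^ 2 ≤ q ^ 2)
    {p : ℝ × ℝ} (hp : p ∈ rect t) :
    u p.1 p.2 - v p.1 p.2 ≤ m + 4 * heatBound t * q := by
  have := isFiniteMeasure_volume_restrict_rect S
  have : IsFiniteMeasure (η.restrict (rect S)) := ⟨by simpa using hu.finite_lower⟩
  have : IsFiniteMeasure (ξ.restrict (rect S)) := ⟨by simpa using hu.finite_upper⟩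
  have : IsFiniteMeasure (η'.restrict (rect S)) := ⟨by simpa using hv.finite_lower⟩
  have : IsFiniteMeasure (ξ'.restrict (rect S)) := ⟨by simpa using hv.finite_upper⟩
  have hsub := rect_subset_rect ht.2
  have hau := hF.memLp_drift (α := α) hu.continuousOn hh
  have hav := hF.memLp_drift (α := α) hv.continuousOn hh
  have hsol := ((hu.isWeakSolution hF hh).sub (hv.isWeakSolution hF hh) hu.continuousOn
    hv.continuousOn (hau.integrable (by norm_num)) (hav.integrable (by norm_num))).mono ht.2
  refine hsol.le_add_heatBound_mul ht.1 ((hu.continuousOn.sub hv.continuousOn).mono hsub)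
    ((hau.sub hav).mono_measure (Measure.restrict_mono hsub le_rfl)) ?_ hm (fun x hx => ?_) hq hbq hp
  -- Where u > v, also u > K₁ since v ≥ K₁, and v < K₂ since u ≤ K₂; so neither η nor ξ' charges
  -- this set.
  · rw [Measure.add_apply, add_eq_zero]
    constructor
    · refine measure_mono_null ?_ (hu.lower_null hK)
      rintro p ⟨hp, hlt⟩
      have := (hv.between p.1 hp.1 p.2 (hsub hp).2).1
      exact ⟨hsub hp, by linarith⟩
    · refine measure_mono_null ?_ (hv.upper_null hK)
      rintro p ⟨hp, hlt⟩
      have := (hu.between p.1 hp.1 p.2 (hsub hp).2).2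
      exact ⟨hsub hp, by linarith⟩
  · rw [hu.initial x hx, hv.initial x hx]
    exact hinit x hx

/-- The two-sided, squared form of the a priori bound. -/
theorem IsSolutionTriplet.sq_sub_le {v₀ : ℝ → ℝ} {v : ℝ → ℝ → ℝ} {η' ξ' : Measure (ℝ × ℝ)}
    (hu : IsSolutionTriplet K₁ K₂ α f σ h u₀ S u η ξ)
    (hv : IsSolutionTriplet K₁ K₂ α f σ h v₀ S v η' ξ')
    (hK : AdmissibleWalls K₁ K₂) (hF : AdmissibleCoefficients f σ) (hh : IsControl S h)
    {m t : ℝ} (hm : 0 ≤ m) (hinit : ∀ x ∈ Icc (0 : ℝ) 1, |u₀ x - v₀ x| ≤ m) (ht : t ∈ Icc 0 S)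
    {p : ℝ × ℝ} (hp : p ∈ rect t) :
    (u p.1 p.2 - v p.1 p.2) ^ 2 ≤ 2 * m ^ 2 + 2 * (4 * heatBound S) ^ 2 *
      ∫ p in rect t, (drift α f σ h u p - drift α f σ h v p) ^ 2 := by
  set I : ℝ := ∫ p in rect t, (drift α f σ h u p - drift α f σ h v p) ^ 2 with hI
  have hI' : ∫ p in rect t, (drift α f σ h v p - drift α f σ h u p) ^ 2 = I := by
    rw [hI]
    exact integral_congr_ae (Filter.Eventually.of_forall fun p => by simp only; ring)
  have hI0 : 0 ≤ I := integral_nonneg fun p => sq_nonneg _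
  have hZ : 0 < heatBound S := heatBound_pos (ht.1.trans ht.2)
  have hZt : heatBound t ≤ heatBound S := by unfold heatBound; linarith [ht.2]
  have habs : |u p.1 p.2 - v p.1 p.2| ≤ m + 4 * heatBound S * Real.sqrt I := by
    refine le_of_forall_pos_le_add fun ε hε => ?_
    -- The one-sided bound requires q > 0, whereas I may vanish; hence the slack ε.
    set q : ℝ := Real.sqrt I + ε / (4 * heatBound S) with hq
    have hq0 : 0 < q := by positivity
    have hIq : I ≤ q ^ 2 := by
      rw [← Real.sqrt_le_left hq0.le, hq]
      linarith [show 0 < ε / (4 * heatBound S) by positivity]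
    have h1 := hu.sub_le hv hK hF hh hm (fun x hx => (abs_le.1 (hinit x hx)).2) hq0 ht hIq hp
    have h2 := hv.sub_le hu hK hF hh hm
      (fun x hx => by linarith [(abs_le.1 (hinit x hx)).1]) hq0 ht (hI'.trans_le hIq) hp
    have h3 : 4 * heatBound t * q ≤ 4 * heatBound S * q := by gcongr
    have h4 : 4 * heatBound S * q = 4 * heatBound S * Real.sqrt I + ε := by
      rw [hq]; field_simp
    rw [abs_le]
    constructor <;> linarith
  have hs := Real.sq_sqrt hI0
  rw [← sq_abs]
  calc |u p.1 p.2 - v p.1 p.2| ^ 2 ≤ (m + 4 * heatBound S * Real.sqrt I) ^ 2 :=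
        pow_le_pow_left₀ (abs_nonneg _) habs 2
    _ ≤ 2 * m ^ 2 + 2 * (4 * heatBound S) ^ 2 * Real.sqrt I ^ 2 := by
        nlinarith [sq_nonneg (m - 4 * heatBound S * Real.sqrt I)]
    _ = _ := by rw [hs]

end Triplets

/-! ### Lipschitz dependence on the initial value. -/

theorem integral_sq_eq_controlNorm_sq {S : ℝ} {h : ℝ → ℝ → ℝ} (hh : IsControl S h) :
    ∫ p in rect S, h p.1 p.2 ^ 2 = controlNorm S h ^ 2 := by
  have h0 : 0 ≤ ∫ p in rect S, h p.1 p.2 ^ 2 := integral_nonneg fun p => sq_nonneg _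
  have h1 : ∫ p in rect S, ‖Function.uncurry h p‖ ^ (2 : ENNReal).toReal =
      ∫ p in rect S, h p.1 p.2 ^ 2 :=
    integral_congr_ae (Filter.Eventually.of_forall fun p => by simp [Function.uncurry])
  have h2 : (∫ p in rect S, h p.1 p.2 ^ 2) ^ ((2 : ENNReal).toReal)⁻¹ =
      Real.sqrt (∫ p in rect S, h p.1 p.2 ^ 2) := by
    rw [Real.sqrt_eq_rpow]; norm_num
  rw [controlNorm, MemLp.eLpNorm_eq_integral_rpow_norm (by norm_num) (by norm_num) hh, h1, h2,
    ENNReal.toReal_ofReal (Real.sqrt_nonneg _), Real.sq_sqrt h0]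

/-- The number of doublings needed in the Gronwall argument. -/
noncomputable def doublings (α L S r : ℝ) : ℕ :=
  ⌈2 * (2 * (4 * heatBound S) ^ 2) * (2 * (|α| + L) ^ 2 * S + 2 * L ^ 2 * r ^ 2)⌉₊

/-- Solutions depend on their initial values in a Lipschitz continuous way. -/
theorem IsSolutionTriplet.sq_sub_le_two_pow {K₁ K₂ u₀ v₀ : ℝ → ℝ} {α S L : ℝ}
    {f σ h u v : ℝ → ℝ → ℝ} {η ξ η' ξ' : Measure (ℝ × ℝ)} (hS : 0 ≤ S)
    (hu : IsSolutionTriplet K₁ K₂ α f σ h u₀ S u η ξ)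
    (hv : IsSolutionTriplet K₁ K₂ α f σ h v₀ S v η' ξ')
    (hK : AdmissibleWalls K₁ K₂) (hF : AdmissibleCoefficients f σ)
    (hL : ∀ x ∈ Icc (0 : ℝ) 1, ∀ y y' : ℝ, |f x y - f x y'| + |σ x y - σ x y'| ≤ L * |y - y'|)
    (hh : IsControl S h) {m : ℝ} (hm : 0 ≤ m)
    (hinit : ∀ x ∈ Icc (0 : ℝ) 1, |u₀ x - v₀ x| ≤ m) {p : ℝ × ℝ} (hp : p ∈ rect S) :
    (u p.1 p.2 - v p.1 p.2) ^ 2 ≤ 2 ^ doublings α L S (controlNorm S h) * (2 * m ^ 2) := by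
  have := isFiniteMeasure_volume_restrict_rect S
  set B : ℝ := 2 * (4 * heatBound S) ^ 2 with hB
  have hB0 : 0 < B := by have := heatBound_pos hS; positivity
  set k : ℝ × ℝ → ℝ := fun p => |α| + L + L * |h p.1 p.2| with hk
  have hkL : MemLp k 2 (volume.restrict (rect S)) :=
    (memLp_const (|α| + L)).add (MemLp.const_mul hh.abs L)
  have hki : IntegrableOn (fun p => k p ^ 2) (rect S) := hkL.integrable_sq
  set d : ℝ × ℝ → ℝ := fun p => drift α f σ h u p - drift α f σ h v p with hd
  have hdL : MemLp d 2 (volume.restrict (rect S)) :=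
    (hF.memLp_drift hu.continuousOn hh).sub (hF.memLp_drift hv.continuousOn hh)
  have hdi : IntegrableOn (fun p => d p ^ 2) (rect S) := hdL.integrable_sq
  have hdk : ∀ p ∈ rect S, d p ^ 2 ≤ k p ^ 2 * (u p.1 p.2 - v p.1 p.2) ^ 2 := fun p hp => by
    rw [← mul_pow, ← sq_abs (d p), ← sq_abs (k p * _)]
    refine pow_le_pow_left₀ (abs_nonneg _) ((abs_drift_sub_le hL hp).trans ?_) 2
    rw [abs_mul]
    exact mul_le_mul_of_nonneg_right (le_abs_self _) (abs_nonneg _)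
  set A : ℝ → ℝ := fun t => ∫ p in rect t, k p ^ 2 with hA
  set H : ℝ → ℝ := fun t => 2 * m ^ 2 + B * ∫ p in rect t, d p ^ 2 with hH
  have hzero : ∀ g : ℝ × ℝ → ℝ, IntegrableOn g (rect S) → ∫ p in rect 0, g p = 0 := fun g hg => by
    rw [integral_rect_eq le_rfl (hg.mono_set (rect_subset_rect hS)), intervalIntegral.integral_same]
  have hwH : ∀ t ∈ Icc 0 S, ∀ p ∈ rect t, (u p.1 p.2 - v p.1 p.2) ^ 2 ≤ H t := fun t ht p hp =>
    hu.sq_sub_le hv hK hF hh hm hinit ht hp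
  -- Between times s and t, d² ≤ k²(u - v)², and (u - v)² is bounded by H(t) on the whole of `rect
  -- t`; H(t) thus factors out of the integral.
  have hstep : ∀ s t, 0 ≤ s → s ≤ t → t ≤ S → H t - H s ≤ B * (A t - A s) * H t := by
    intro s t hs hst ht
    have hsub := rect_subset_rect ht
    have e1 : ∀ g : ℝ × ℝ → ℝ, IntegrableOn g (rect S) →
        (∫ p in rect t, g p) - (∫ p in rect s, g p) = ∫ p in rect t \ rect s, g p := fun g hg =>
      (setIntegral_sdiff (measurableSet_rect s) (hg.mono_set hsub) (rect_subset_rect hst)).symm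
    have hdiff : H t - H s = B * ((∫ p in rect t, d p ^ 2) - ∫ p in rect s, d p ^ 2) := by
      simp only [hH]; ring
    have hkH : IntegrableOn (fun p => k p ^ 2 * H t) (rect S) := hki.mul_const _
    rw [hdiff, mul_assoc B, e1 _ hdi, e1 _ hki, ← integral_mul_const]
    refine mul_le_mul_of_nonneg_left ?_ hB0.le
    refine setIntegral_mono_on (hdi.mono_set (sdiff_subset.trans hsub))
      (hkH.mono_set (sdiff_subset.trans hsub))
      ((measurableSet_rect t).diff (measurableSet_rect s)) fun p hp => ?_
    exact (hdk p (hsub hp.1)).trans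
      (mul_le_mul_of_nonneg_left (hwH t ⟨hs.trans hst, ht⟩ p hp.1) (sq_nonneg _))
  have hAS : A S ≤ 2 * (|α| + L) ^ 2 * S + 2 * L ^ 2 * controlNorm S h ^ 2 := by
    have hhi : IntegrableOn (fun p : ℝ × ℝ => h p.1 p.2 ^ 2) (rect S) := hh.integrable_sq
    calc A S ≤ ∫ p in rect S, (2 * (|α| + L) ^ 2 + 2 * L ^ 2 * h p.1 p.2 ^ 2) := by
          refine integral_mono hki ((integrable_const _).add (hhi.const_mul _)) fun p => ?_
          simp only [hk]
          rw [← sq_abs (h p.1 p.2)]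
          nlinarith [sq_nonneg (|α| + L - L * |h p.1 p.2|)]
      _ = _ := by
          rw [integral_add (integrable_const _) (hhi.const_mul _), integral_const_mul (2 * L ^ 2),
            integral_sq_eq_controlNorm_sq hh, integral_const, smul_eq_mul, measureReal_restrict_apply_univ,
            rect, Measure.volume_eq_prod, measureReal_prod_prod]
          simp [hS, mul_comm]
  have hfin := le_two_pow_mul_of_sub_le hB0 (continuousOn_integral_rect hS hki) (hzero _ hki)
    (fun t ht => (sq_nonneg _).trans (hwH t ht (0, 0) ⟨by simp, by simpa using ht.1⟩)) hstep
    (doublings α L S (controlNorm S h)) S ⟨hS, le_rfl⟩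
    ((mul_le_mul_of_nonneg_left hAS (by positivity)).trans (Nat.le_ceil _))
  refine (hwH S ⟨hS, le_rfl⟩ p hp).trans (hfin.trans_eq ?_)
  simp only [hH, hzero _ hdi]
  ring

theorem abs_le_supNorm {z : ℝ → ℝ} (hz : ContinuousOn z (Icc 0 1)) {x : ℝ}
    (hx : x ∈ Icc (0 : ℝ) 1) : |z x| ≤ supNorm z :=
  le_csSup (isCompact_Icc.image_of_continuousOn hz.abs).bddAbove (mem_image_of_mem _ hx)

end ReflectedSkeleton

theorem proposition7p1 (K₁ K₂ : ℝ → ℝ) (hK : ReflectedSkeleton.AdmissibleWalls K₁ K₂)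
    (α : ℝ) (f σ : ℝ → ℝ → ℝ) (hF : ReflectedSkeleton.AdmissibleCoefficients f σ) :
    ∃ C : ℝ → ℝ → ℝ,
      ∀ T₀ : ℝ, 0 < T₀ →
      ∀ h : ℝ → ℝ → ℝ, ReflectedSkeleton.IsControl T₀ h →
      ∀ z : ℝ → ℝ, ReflectedSkeleton.IsState K₁ K₂ z →
      ∀ T : ℝ, 0 < T →
      ∀ u ψ ψ' : ℝ → ℝ → ℝ,
        ReflectedSkeleton.IsSkeletonSolution K₁ K₂ α f σ (fun _ _ => 0) z T u →
        ReflectedSkeleton.IsSkeletonSolution K₁ K₂ α f σ h (fun _ => 0) T₀ ψ →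
        ReflectedSkeleton.IsSkeletonSolution K₁ K₂ α f σ h (fun x => u x T) T₀ ψ' →
        ReflectedSkeleton.supDist ψ ψ' T₀ ≤
          C T₀ (ReflectedSkeleton.controlNorm T₀ h) *
            ReflectedSkeleton.supNorm (fun x => u x T) := by
  obtain ⟨L, -, hL⟩ := hF.lipschitz
  -- With N doublings and H(0) = 2m², the squared difference is at most 2^N · 2m²; its root is C ·
  -- m. N depends only on α, L, S and r.
  refine ⟨fun S r => Real.sqrt (2 ^ ReflectedSkeleton.doublings α L S r * 2), ?_⟩
  rintro T₀ hT₀ h hh z - T hT u ψ ψ' ⟨η, ξ, hu⟩ ⟨η₁, ξ₁, hψ⟩ ⟨η₂, ξ₂, hψ'⟩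
  have hcont : ContinuousOn (fun x => u x T) (Icc 0 1) :=
    ReflectedSkeleton.continuousOn_slice hu.continuousOn ⟨hT.le, le_rfl⟩
  have hm : 0 ≤ ReflectedSkeleton.supNorm fun x => u x T :=
    (abs_nonneg _).trans (ReflectedSkeleton.abs_le_supNorm hcont (left_mem_Icc.2 zero_le_one))
  refine csSup_le (Set.Nonempty.image _ ⟨(0, 0), by simp [ReflectedSkeleton.rect, hT₀.le]⟩) ?_
  rintro _ ⟨p, hp, rfl⟩
  have hsq := hψ.sq_sub_le_two_pow hT₀.le hψ' hK hF hL hh hm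
    (fun x hx => by simpa using ReflectedSkeleton.abs_le_supNorm hcont hx) hp
  refine abs_le_of_sq_le_sq (hsq.trans_eq ?_) (by positivity)
  rw [mul_pow, Real.sq_sqrt (by positivity)]
  ring
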